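/- **Setting.** Let $K\ge 2$. A degree-corrected block model (DCBM) on the nodes $[n]$ has labels $\pi_i\in\{e_1,\dots,e_K\}$, degree parameters $\theta_i\in(0,1]$ and a symmetric entrywise nonnegative $P\in\mathbb R^{K\times K}$ with $P_{kk}=1$. The adjacency matrix $A$ is symmetric with zero diagonal, and its entries above the diagonal are independent Bernoulli variables with $\mathbb P(A_{ij}=1)=\theta_i\theta_j\,\pi_i'P\pi_j$. The nodes are split into labeled nodes $\mathcal L$ and a nonempty set $\mathcal U=[n]\setminus\mathcal L$ of unlabeled nodes. Let $\mathcal C_k=\{i:\pi_i=e_k\}$. Let $\theta^{(k)}$ and $\theta^{(k)}_{\mathcal L}$ be the restrictions of $\theta$ to $\mathcal C_k$ and to $\mathcal C_k\cap\mathcal L$. Write $\|\cdot\|$ for the Euclidean norm. For each $i\in\mathcal U$, a community detection procedure that sees only the sub-network on $\mathcal U\setminus\{i\}$ outputs labels $\hat\pi_j$ for $j\in\mathcal U\setminus\{i\}$. They form the membership matrix $H_i=\hat\Pi_{\mathcal U\setminus\{i\}}$. It is called $b_0$-correct if $\min_T\sum_{j\in\mathcal U\setminus\{i\}}\theta_j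 1\{T\hat\pi_j\ne\pi_j\}\le b_0\|\theta\|_1$, where $T$ ranges over the permutations of the $K$ labels. Let $B_i$ be the event that this holds. Let $A^{(k)}_j=\sum_{l\in\mathcal L\cap\mathcal C_k}A_{lj}$. For a vector $x$ indexed by $[n]\setminus\{i\}$, let $f(x;H_i)\in\mathbb R^{2K}$ consist of the $K$ sums $\sum_{j\in\mathcal L\cap\mathcal C_k}x_j$ followed by the $K$ entries of $x_{\mathcal U\setminus\{i\}}'H_i$. Let $\psi(u,v)$ be the angle between $u$ and $v$, with value $\pi/2$ if one of them is zero. In-sample AngleMin+ is $\hat y_i\in\arg\min_k\psi\big(f(A^{(k)}_{-i};H_i),f(A_{-i,i};H_i)\big)$ for $i\in\mathcal U$, with ties broken in any way. For a classifier $\tilde y=(\tilde y_i)_{i\in\mathcal U}$, a function of $A$ that may depend on all the parameters (but, for each $i$, is the same function of $A$ for every value of $\pi_i$ below), put $$\mathrm{Risk}_{ins}(\tilde y)=\frac1{|\mathcal U|}\sum_{i\in\mathcal U}\sum_{k=1}^K\mathbb P(\tilde y_i\ne k\mid\pi_i=e_k),$$ where $\mathbb P(\cdot\mid\pi_i=e_k)$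 is the law of the network when the label of node $i$ is $k$ and all other parameters are unchanged. Put $$\mathrm{Risk}_{ins}(\tilde y\mid B)=\frac1{|\mathcal U|}\sum_{i\in\mathcal U}\sum_{k=1}^K\mathbb P(\tilde y_i\ne k\mid B_i,\pi_i=e_k).$$ **Theorem.** For all $K\ge2$ and $C_1,C_2>0$ there are $\bar b,\bar c,\bar C>0$ such that for all $r_0>0$, $0<c_3\le\bar c$ and $C_3\ge\bar C$ there is a constant $\tilde c_{21}=\tilde c_{21}(K,C_1,C_2,C_3,c_3,r_0)>0$ with the following property. Let $b_0\in(0,1)$ with $b_0\le\bar b$, let $n\ge1$ and $\beta_n>0$, and consider any DCBM on $[n]$ with any $\mathcal L$, any detection procedures and AngleMin+ $\hat y$ as above, such that * $\max_{k,\ell}|P_{k\ell}|\le C_1$, and every eigenvalue $\lambda$ of $P$ satisfies $|\lambda|\ge\beta_n$; * $\max_k\|\theta^{(k)}\|_1\le C_2\min_k\|\theta^{(k)}\|_1$, and $\|\theta^{(k)}_{\mathcal L}\|^2\le c_3\beta_n\|\theta^{(k)}_{\mathcal L}\|_1\|\theta\|_1$ for all $k$; * $\max_{i\in\mathcal U}\theta_i\le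 1/C_3$ and $\max_{i\in\mathcal U}\theta_i\le C_3\min_k\|\theta^{(k)}_{\mathcal L}\|_1$; * $\log|\mathcal U|\le C_3\beta_n^2\|\theta\|_1\min_{i\in\mathcal U}\theta_i$; * $\min_{k\ne\ell}P_{k\ell}\ge r_0$. Then $\inf_{\tilde y}\mathrm{Risk}_{ins}(\tilde y)>0$. If $\hat\Pi_{\mathcal U\setminus\{i\}}$ is almost surely $b_0$-correct for every $i\in\mathcal U$, then $$\frac{-\log\big(\tilde c_{21}\,\mathrm{Risk}_{ins}(\hat y)\big)}{-\log\big(\inf_{\tilde y}\mathrm{Risk}_{ins}(\tilde y)\big)}\ \ge\ \tilde c_{21}\qquad\text{whenever }\inf_{\tilde y}\mathrm{Risk}_{ins}(\tilde y)<1,$$ and in every case $-\log(\tilde c_{21}\mathrm{Risk}_{ins}(\hat y))\ge\tilde c_{21}\cdot\big(-\log\inf_{\tilde y}\mathrm{Risk}_{ins}(\tilde y)\big)$. If only $\mathbb P(B_i)>0$ for every $i\in\mathcal U$, the same inequalities hold with $\mathrm{Risk}_{ins}(\hat y)$ replaced by $\mathrm{Risk}_{ins}(\hat y\mid B)$. 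-/

import Mathlib

open MeasureTheory ProbabilityTheory

noncomputable section

namespace SemiSup

/-- The unordered pairs of distinct nodes, listed as the ordered pairs `(i, j)` with `i < j`. -/
abbrev Pair (n : ℕ) : Type := {e : Fin n × Fin n // e.1 < e.2}

/-- A realization of the network: which pairs of nodes are joined by an edge. -/
abbrev Config (n : ℕ) : Type := Pair n → Bool

/-- The symmetric 0-1 adjacency matrix `A` (zero diagonal) of a realization. -/
def adjacency {n : ℕ} (ω : Config n) : Matrix (Fin n) (Fin n) ℝ := fun i j =>
  if h : i < j then (if ω ⟨(i, j), h⟩ = true then 1 else 0)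
  else if h : j < i then (if ω ⟨(j, i), h⟩ = true then 1 else 0)
  else 0

/-- The parameters of a degree-corrected block model on `n` nodes with `K` communities:
community labels, degree parameters and the `K × K` matrix `P`. -/
structure Params (n K : ℕ) where
  label : Fin n → Fin K
  theta : Fin n → ℝ
  P : Matrix (Fin K) (Fin K) ℝ

namespace Params

variable {n K : ℕ}

/-- `Ω i j = θ_i θ_j π_i' P π_j`, the probability of an edge between `i ≠ j`. -/
def Omega (M : Params n K) (i j : Fin n) : ℝ :=
  M.theta i * M.theta j * M.P (M.label i) (M.label j)

/-- The requirements on the parameters of a DCBM, including the identifiability convention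
that the diagonal of `P` is `1`. -/
structure IsDCBM (M : Params n K) : Prop where
  theta_pos : ∀ i, 0 < M.theta i
  theta_le_one : ∀ i, M.theta i ≤ 1
  P_symm : M.P.IsSymm
  P_nonneg : ∀ k l, 0 ≤ M.P k l
  P_diag : ∀ k, M.P k k = 1
  Omega_le_one : ∀ i j, i ≠ j → M.Omega i j ≤ 1

/-- The law of the network: independent edges, `(i, j)` being present with probability `Ω i j`.
(The projection to `[0, 1]` is the identity whenever `Ω i j` is a probability.) -/
def law (M : Params n K) : Measure (Config n) :=
  Measure.pi fun e : Pair n =>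
    bernoulliMeasure true false (Set.projIcc (0 : ℝ) 1 zero_le_one (M.Omega e.1.1 e.1.2))

/-- The same model in which node `i` has label `k` instead; its law is `ℙ(· | π_i = e_k)`. -/
def relabel (M : Params n K) (i : Fin n) (k : Fin K) : Params n K :=
  { M with label := Function.update M.label i k }

/-- The nodes of `S` in community `k`. -/
def comm (M : Params n K) (S : Finset (Fin n)) (k : Fin K) : Finset (Fin n) :=
  S.filter fun j => M.label j = k

/-- The `ℓ¹` norm of `θ` restricted to `S`. -/
def l1 (M : Params n K) (S : Finset (Fin n)) : ℝ := ∑ j ∈ S, |M.theta j|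

/-- The squared `ℓ²` norm of `θ` restricted to `S`. -/
def l2sq (M : Params n K) (S : Finset (Fin n)) : ℝ := ∑ j ∈ S, M.theta j ^ 2

/-- `‖P‖_max ≤ C₁`, and every eigenvalue of `P` is at least `β` in magnitude. -/
def CondP (M : Params n K) (C₁ β : ℝ) : Prop :=
  (∀ k l, |M.P k l| ≤ C₁) ∧
    ∀ μ : ℝ, Module.End.HasEigenvalue (Matrix.toLin' M.P) μ → β ≤ |μ|

/-- `max_k ‖θ^(k)‖₁ ≤ C₂ min_k ‖θ^(k)‖₁`, and
`‖θ_L^(k)‖² ≤ c₃ β ‖θ_L^(k)‖₁ ‖θ‖₁` for all `k`. -/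
def CondTheta (M : Params n K) (L : Finset (Fin n)) (C₂ c₃ β : ℝ) : Prop :=
  (∀ k l, M.l1 (M.comm Finset.univ k) ≤ C₂ * M.l1 (M.comm Finset.univ l)) ∧
    ∀ k, M.l2sq (M.comm L k) ≤ c₃ * β * M.l1 (M.comm L k) * M.l1 Finset.univ

/-- Labels `p` for the nodes of `S` are `b₀`-correct: up to a permutation of the `K` communities,
the degree-weighted number of errors is at most `b₀ ‖θ‖₁`. -/
def IsCorrect (M : Params n K) (S : Finset (Fin n)) (b₀ : ℝ) (p : {j // j ∈ S} → Fin K) : Prop :=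
  ∃ T : Equiv.Perm (Fin K),
    ∑ j : {j // j ∈ S}, (if T (p j) ≠ M.label j then M.theta j else 0) ≤ b₀ * M.l1 Finset.univ

end Params

variable {n K : ℕ}

/-- For every node `i`, an unsupervised community detection procedure for the sub-network on
`U \ {i}`: it sees only the adjacency matrix of that sub-network, and labels its nodes. -/
abbrev Detection (n K : ℕ) (U : Finset (Fin n)) : Type :=
  ∀ i : Fin n, Matrix {j // j ∈ U.erase i} {j // j ∈ U.erase i} ℝ → {j // j ∈ U.erase i} → Fin K

/-- The labels of `U \ {i}` that the procedure outputs on the network `ω`. -/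
def Detection.labels {U : Finset (Fin n)} (D : Detection n K U) (i : Fin n) (ω : Config n) :
    {j // j ∈ U.erase i} → Fin K :=
  D i ((adjacency ω).submatrix Subtype.val Subtype.val)

/-- The event that the labels of `U \ {i}` are `b₀`-correct. -/
def correctEvent {U : Finset (Fin n)} (M : Params n K) (D : Detection n K U) (b₀ : ℝ)
    (i : Fin n) : Set (Config n) :=
  {ω | M.IsCorrect (U.erase i) b₀ (D.labels i ω)}

/-- The membership matrix with rows `e_{p j}`. -/
def membership {S : Finset (Fin n)} (p : {j // j ∈ S} → Fin K) :
    Matrix {j // j ∈ S} (Fin K) ℝ := fun j k => if p j = k then 1 else 0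

/-- `A^(k)`, the sum of the columns of `A` over the labeled nodes in community `k`. -/
def aggregate (M : Params n K) (L : Finset (Fin n)) (ω : Config n) (k : Fin K) : Fin n → ℝ :=
  fun j => ∑ i ∈ M.comm L k, adjacency ω i j

/-- The projection `f(x; H) ∈ ℝ^{2K}`: the sums of `x` over the labeled nodes of each community,
followed by `x_S' H`. Only the coordinates of `x` in `L ∪ S` are used. -/
def feature (M : Params n K) (L S : Finset (Fin n)) (H : Matrix {j // j ∈ S} (Fin K) ℝ)
    (x : Fin n → ℝ) : EuclideanSpace ℝ (Fin K ⊕ Fin K) :=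
  WithLp.toLp 2 (Sum.elim (fun k => ∑ j ∈ M.comm L k, x j)
    (fun k => ∑ j : {j // j ∈ S}, x j * H j k))

/-- The angle between `f(A^(k)_{-i}; H_i)` and `f(A_{-i,i}; H_i)`, where `H_i` is the estimated
membership matrix of `U \ {i}` and `U` is the complement of `L`. -/
def psiHat (M : Params n K) (L : Finset (Fin n)) (D : Detection n K Lᶜ) (ω : Config n)
    (i : Fin n) (k : Fin K) : ℝ :=
  InnerProductGeometry.angle
    (feature M L (Lᶜ.erase i) (membership (D.labels i ω)) (aggregate M L ω k))
    (feature M L (Lᶜ.erase i) (membership (D.labels i ω)) (fun j => adjacency ω j i))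

/-- An in-sample classifier: a function of the network that labels every node of `U`. -/
abbrev Classifier (n K : ℕ) (U : Finset (Fin n)) : Type := Config n → {i // i ∈ U} → Fin K

/-- `y` is the in-sample AngleMin+ classifier: `y_i` minimizes the angle over the communities
(ties broken in any way). -/
def IsAngleMinPlus (M : Params n K) (L : Finset (Fin n)) (D : Detection n K Lᶜ)
    (y : Classifier n K Lᶜ) : Prop :=
  ∀ ω (i : {i // i ∈ Lᶜ}) (k : Fin K), psiHat M L D ω i (y ω i) ≤ psiHat M L D ω i k

/-- The in-sample risk `|U|⁻¹ ∑_{i ∈ U} ∑_k ℙ(y_i ≠ k | π_i = e_k)`. -/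
def riskIns {U : Finset (Fin n)} (M : Params n K) (y : Classifier n K U) : ℝ :=
  (∑ i : {i // i ∈ U}, ∑ k : Fin K, (M.relabel i k).law.real {ω | y ω i ≠ k}) / U.card

/-- The in-sample risk given events `B i`:
`|U|⁻¹ ∑_{i ∈ U} ∑_k ℙ(y_i ≠ k | B i, π_i = e_k)`. -/
def riskInsGiven {U : Finset (Fin n)} (M : Params n K) (B : Fin n → Set (Config n))
    (y : Classifier n K U) : ℝ :=
  (∑ i : {i // i ∈ U}, ∑ k : Fin K, (ProbabilityTheory.cond (M.relabel i k).law (B i)).real {ω | y ω i ≠ k}) /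
    U.card

/-- The infimum of the in-sample risk over all classifiers; a classifier may depend on all
the parameters, but the same function of the network is used for every value of `π_i`. -/
def bestRiskIns (M : Params n K) (U : Finset (Fin n)) : ℝ :=
  ⨅ y : Classifier n K U, riskIns M y

/-- The comparison of a risk `r` with the best risk `s` on the scale of exponents, with constant
`c`: `[-log (c r)] / [-log s] ≥ c` whenever `s < 1`, and in any case the same inequality
with the denominator cleared. -/
def RateEfficient (c r s : ℝ) : Prop :=
  (s < 1 → c ≤ (-Real.log (c * r)) / (-Real.log s)) ∧ c * (-Real.log s) ≤ -Real.log (c * r)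

end SemiSup

end

/-! Let `δ` be the smallest sup-norm distance between two rows of `P`, and put `x_i = δ² θ_i ‖θ‖₁`.
Up to constants in the exponent, both the best error and the error of AngleMin+ at node `i` are of
order `exp(-x_i)`.

Lower bound (`Params.exp_le_law_add_law`, `le_riskIns`): take the two closest rows `k`, `l`.
Relabeling `i` from `k` to `l` changes only the edges at `i`, whose probabilities are `θ_i θ_v
P_{k,π_v}` and `θ_i θ_v P_{l,π_v}`. Multiplying the Bhattacharyya coefficients of these edges gives
at least `exp(-x_i/r)`, where `r` is a lower bound for the entries of `P`. By Cauchy-Schwarz, the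
two error probabilities of any test add up to at least half the square of this product.

Upper bound (`law_inter_error_le`): the labels estimated for `U \ {i}` depend only on edges inside
that set, while the projected vectors use only the other edges. Given the former, every coordinate
is a weighted sum of independent edges, and Chernoff's bound keeps it within relative error of order
`εδ` outside probability `2 exp(-κ x_i)`. Zero diagonal entries of `A` cause a bias, which the
assumption on `‖θ_L^(k)‖²` absorbs since `β ≤ K δ`. The normalized vectors are then close to
projections of rows of `P`. Approximate correctness makes the projection bounded below
(`le_norm_profile`), and the unit diagonal of `P` separates the rays of its rows
(`norm_sub_le_mul_norm_sub_smul`), so the angle with the true community is strictly smallest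
(`angle_lt_angle_of_close`).

The risks are averages of such exponentials over `U`. Jensen's inequality for the concave map `t ↦ t
^ c` compares these averages (`mul_le_rpow_of_exp_averages`). The almost sure case reduces to the
conditional one, because relabeling `i` preserves null sets (`law_relabel_real_eq_zero`). -/

noncomputable section

namespace SemiSup

/-! ### Products of Bernoulli laws: conditioning, Chernoff bound, two-point lower bound. -/

section BernoulliProduct

variable {ι : Type*} [Fintype ι]

/-- The mass at `ω` of independent Bernoulli variables with success probabilities `p`. -/
def bernMass (p : ι → ℝ) (ω : ι → Bool) : ℝ := ∏ e, if ω e = true then p e else 1 - p e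

theorem bernMass_nonneg {p : ι → ℝ} (h0 : ∀ e, 0 ≤ p e) (h1 : ∀ e, p e ≤ 1) (ω : ι → Bool) :
    0 ≤ bernMass p ω :=
  Finset.prod_nonneg fun e _ => by
    split_ifs
    · exact h0 e
    · linarith [h1 e]

variable [DecidableEq ι]

/-- The probability of `S` under independent Bernoulli variables with success probabilities `p`. -/
def bernProb (p : ι → ℝ) (S : Set (ι → Bool)) : ℝ := ∑ ω, S.indicator (bernMass p) ω

theorem bernProb_nonneg {p : ι → ℝ} (h0 : ∀ e, 0 ≤ p e) (h1 : ∀ e, p e ≤ 1)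
    (S : Set (ι → Bool)) : 0 ≤ bernProb p S :=
  Finset.sum_nonneg fun _ _ => Set.indicator_nonneg (fun _ _ => bernMass_nonneg h0 h1 _) _

theorem bernProb_mono {p : ι → ℝ} (h0 : ∀ e, 0 ≤ p e) (h1 : ∀ e, p e ≤ 1)
    {S T : Set (ι → Bool)} (h : S ⊆ T) : bernProb p S ≤ bernProb p T :=
  Finset.sum_le_sum fun _ _ =>
    Set.indicator_le_indicator_of_subset h (fun _ => bernMass_nonneg h0 h1 _) _

theorem bernProb_iUnion_le {κ : Type*} [Fintype κ] {p : ι → ℝ} (h0 : ∀ e, 0 ≤ p e)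
    (h1 : ∀ e, p e ≤ 1) (S : κ → Set (ι → Bool)) :
    bernProb p (⋃ a, S a) ≤ ∑ a, bernProb p (S a) := by
  unfold bernProb
  rw [Finset.sum_comm]
  refine Finset.sum_le_sum fun ω _ => ?_
  have hnn : ∀ a ∈ Finset.univ, 0 ≤ (S a).indicator (bernMass p) ω := fun a _ =>
    Set.indicator_nonneg (fun _ _ => bernMass_nonneg h0 h1 _) _
  by_cases h : ω ∈ ⋃ a, S a
  · obtain ⟨a, ha⟩ := Set.mem_iUnion.1 h
    rw [Set.indicator_of_mem h, ← Set.indicator_of_mem ha (bernMass p)]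
    exact Finset.single_le_sum hnn (Finset.mem_univ a)
  · rw [Set.indicator_of_notMem h]
    exact Finset.sum_nonneg hnn

theorem sum_prod_bool (g : ι → Bool → ℝ) :
    ∑ ω : ι → Bool, ∏ e, g e (ω e) = ∏ e, (g e true + g e false) := by
  classical
  simp_rw [← Fintype.sum_bool]
  exact (Fintype.prod_sum _).symm

theorem sum_bernMass_mul_prod (p : ι → ℝ) (h : ι → Bool → ℝ) :
    ∑ ω : ι → Bool, bernMass p ω * ∏ e, h e (ω e)
      = ∏ e, (p e * h e true + (1 - p e) * h e false) := by
  simp_rw [bernMass, ← Finset.prod_mul_distrib]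
  exact (sum_prod_bool fun e b => (if b = true then p e else 1 - p e) * h e b).trans (by simp)

theorem sum_bernMass (p : ι → ℝ) : ∑ ω : ι → Bool, bernMass p ω = 1 := by
  simpa using sum_bernMass_mul_prod p fun _ _ => 1

/-- Splitting a sum over configurations along a partition of the coordinates. -/
theorem sum_bernMass_split (p : ι → ℝ) (E : ι → Prop) [DecidablePred E]
    (F : (ι → Bool) → ℝ) :
    ∑ ω, bernMass p ω * F ω =
      ∑ a : {e // E e} → Bool, bernMass (fun e : {e // E e} => p e) a *
        ∑ b : {e // ¬ E e} → Bool, bernMass (fun e : {e // ¬ E e} => p e) b *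
          F ((Equiv.piEquivPiSubtypeProd E fun _ => Bool).symm (a, b)) := by
  rw [← (Equiv.piEquivPiSubtypeProd E fun _ => Bool).symm.sum_comp, Fintype.sum_prod_type]
  refine Finset.sum_congr rfl fun a _ => ?_
  rw [Finset.mul_sum]
  refine Finset.sum_congr rfl fun b _ => ?_
  rw [← mul_assoc]
  congr 1
  unfold bernMass
  rw [← Fintype.prod_subtype_mul_prod_subtype E]
  congr 1
  · refine Finset.prod_congr rfl fun e _ => ?_
    simp [Equiv.piEquivPiSubtypeProd, e.2]
  · refine Finset.prod_congr rfl fun e _ => ?_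
    simp [Equiv.piEquivPiSubtypeProd, e.2]

/-- The expectation over the coordinates outside `E`, given those in `E`. -/
theorem sum_indicator_mul_prod_le {p : ι → ℝ} (h0 : ∀ e, 0 ≤ p e) (h1 : ∀ e, p e ≤ 1)
    (E : ι → Prop) (B : Set (ι → Bool)) (h : (ι → Bool) → ι → Bool → ℝ)
    (hB : ∀ ω ω', (∀ e, E e → ω e = ω' e) → ω ∈ B → ω' ∈ B)
    (hh : ∀ ω ω', (∀ e, E e → ω e = ω' e) → h ω = h ω')
    (hE : ∀ ω e b, E e → h ω e b = 1) {c : ℝ}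
    (hc : ∀ ω, ∏ e, (p e * h ω e true + (1 - p e) * h ω e false) ≤ c) :
    ∑ ω, bernMass p ω * (B.indicator 1 ω * ∏ e, h ω e (ω e)) ≤ bernProb p B * c := by
  classical
  have hP : bernProb p B = ∑ ω, bernMass p ω * B.indicator 1 ω := by
    refine Finset.sum_congr rfl fun ω _ => ?_
    by_cases hω : ω ∈ B <;> simp [hω]
  rw [hP, sum_bernMass_split p E, sum_bernMass_split p E, Finset.sum_mul]
  refine Finset.sum_le_sum fun a _ => ?_
  rw [mul_assoc]
  refine mul_le_mul_of_nonneg_left ?_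
    (bernMass_nonneg (p := fun e : {e // E e} => p e) (fun e => h0 e) (fun e => h1 e) a)
  set s := (Equiv.piEquivPiSubtypeProd E fun _ => Bool).symm
  -- The value `true` off `E` is arbitrary: `B` and `h` see only the coordinates in `E`, so `ω₀`
  -- represents every configuration extending `a`.
  set ω₀ := s (a, fun _ => true)
  have hs : ∀ b e, E e → s (a, b) e = ω₀ e := by
    intro b e he
    simp [ω₀, s, Equiv.piEquivPiSubtypeProd, he]
  have hs' : ∀ b (e : {e // ¬ E e}), s (a, b) e = b e := by
    intro b e
    simp [s, Equiv.piEquivPiSubtypeProd, e.2]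
  have hBb : ∀ b, B.indicator (1 : (ι → Bool) → ℝ) (s (a, b)) = B.indicator 1 ω₀ := by
    intro b
    by_cases hω : ω₀ ∈ B
    · rw [Set.indicator_of_mem hω,
        Set.indicator_of_mem (hB ω₀ _ (fun e he => (hs b e he).symm) hω)]
      rfl
    · rw [Set.indicator_of_notMem hω,
        Set.indicator_of_notMem fun h' => hω (hB _ ω₀ (hs b) h')]
  have hprod : ∀ b, ∏ e, h (s (a, b)) e (s (a, b) e)
      = ∏ e : {e // ¬ E e}, h ω₀ e (b e) := by
    intro b
    rw [hh _ ω₀ (hs b), ← Fintype.prod_subtype_mul_prod_subtype E]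
    rw [Finset.prod_eq_one fun e _ => hE _ _ _ e.2, one_mul]
    exact Finset.prod_congr rfl fun e _ => by rw [hs']
  have hfull : ∏ e : {e // ¬ E e}, (p e * h ω₀ e true + (1 - p e) * h ω₀ e false) ≤ c := by
    refine le_trans (le_of_eq ?_) (hc ω₀)
    rw [← Fintype.prod_subtype_mul_prod_subtype E]
    have : ∏ e : {e // E e}, (p e * h ω₀ e true + (1 - p e) * h ω₀ e false) = 1 :=
      Finset.prod_eq_one fun e _ => by
        rw [hE _ _ _ e.2, hE _ _ _ e.2]
        ring
    rw [this, one_mul]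
  have hind : 0 ≤ B.indicator (1 : (ι → Bool) → ℝ) ω₀ :=
    Set.indicator_nonneg (fun _ _ => zero_le_one) _
  calc _ = B.indicator 1 ω₀ * ∏ e : {e // ¬ E e},
        (p e * h ω₀ e true + (1 - p e) * h ω₀ e false) := by
        rw [← sum_bernMass_mul_prod (fun e : {e // ¬ E e} => p e) fun e => h ω₀ e,
          Finset.mul_sum]
        refine Finset.sum_congr rfl fun b _ => ?_
        rw [hBb, hprod]
        ring
    _ ≤ B.indicator 1 ω₀ * c := mul_le_mul_of_nonneg_left hfull hind
    _ = _ := by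
        simp_rw [hBb]
        rw [← Finset.sum_mul, sum_bernMass, one_mul]

/-- Uses `1 + x ≤ exp x` and `exp s - 1 - s ≤ s²` for `|s| ≤ 1`. The factor `p` in the exponent
makes deviation bounds scale with the mean instead of the number of edges. -/
theorem bernoulli_mgf_le {p s : ℝ} (h0 : 0 ≤ p) (hs : |s| ≤ 1) :
    p * Real.exp (s * (1 - p)) + (1 - p) * Real.exp (s * (0 - p)) ≤ Real.exp (p * s ^ 2) := by
  have e1 : Real.exp (s * (1 - p)) = Real.exp s * Real.exp (s * (0 - p)) := by
    rw [← Real.exp_add]; ring_nf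
  have e2 : Real.exp s - 1 - s ≤ s ^ 2 := (abs_le.1 (Real.abs_exp_sub_one_sub_id_le hs)).2
  calc _ = Real.exp (s * (0 - p)) * (1 + p * (Real.exp s - 1)) := by rw [e1]; ring
    _ ≤ Real.exp (s * (0 - p)) * Real.exp (p * (Real.exp s - 1)) := by
        gcongr
        linarith [Real.add_one_le_exp (p * (Real.exp s - 1))]
    _ = Real.exp (p * (Real.exp s - 1 - s)) := by rw [← Real.exp_add]; ring_nf
    _ ≤ _ := by gcongr

/-- Chernoff's bound for a weighted sum of the coordinates outside `E`, with weights in `[0, 2]`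
that may depend on the coordinates in `E`, on an event that depends on these only. -/
theorem bernProb_inter_deviation_le {p : ι → ℝ} (h0 : ∀ e, 0 ≤ p e) (h1 : ∀ e, p e ≤ 1)
    (E : ι → Prop) (B : Set (ι → Bool)) (w : (ι → Bool) → ι → ℝ)
    (hB : ∀ ω ω', (∀ e, E e → ω e = ω' e) → ω ∈ B → ω' ∈ B)
    (hw : ∀ ω ω', (∀ e, E e → ω e = ω' e) → w ω = w ω')
    (hwE : ∀ ω e, E e → w ω e = 0) (hw0 : ∀ ω e, 0 ≤ w ω e) (hw2 : ∀ ω e, w ω e ≤ 2)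
    {μ τ : ℝ} (hμ : ∀ ω, ∑ e, w ω e * p e ≤ μ) (hτ0 : 0 ≤ τ) (hτ2 : τ ≤ 2) :
    bernProb p (B ∩ {ω | τ * μ < |∑ e, w ω e * ((if ω e = true then 1 else 0) - p e)|})
      ≤ bernProb p B * (2 * Real.exp (-(τ ^ 2 * μ / 8))) := by
  classical
  set Z : (ι → Bool) → ℝ := fun ω => ∑ e, w ω e * ((if ω e = true then 1 else 0) - p e) with hZ
  -- The tilt `τ / 4` keeps `|τ w / 4| ≤ 1` for `τ, w ≤ 2`. It costs at most `τ² μ / 8` in the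
  -- exponent, against a gain of `τ² μ / 4` from Markov's inequality; `σ = ±1` treats the two tails.
  have key : ∀ σ : ℝ, |σ| = 1 →
      ∑ ω, bernMass p ω * (B.indicator 1 ω * Real.exp (τ / 4 * (σ * Z ω)))
        ≤ bernProb p B * Real.exp (τ ^ 2 * μ / 8) := by
    intro σ hσ
    have := sum_indicator_mul_prod_le h0 h1 E B
      (fun ω e b => Real.exp (τ / 4 * (σ * w ω e) * ((if b = true then 1 else 0) - p e))) hB
      (fun ω ω' h => by simp only [hw ω ω' h])
      (fun ω e b he => by simp [hwE ω e he])
      (c := Real.exp (τ ^ 2 * μ / 8)) ?_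
    · refine le_trans (le_of_eq ?_) this
      refine Finset.sum_congr rfl fun ω _ => ?_
      rw [← Real.exp_sum]
      congr 3
      rw [hZ, Finset.mul_sum, Finset.mul_sum]
      exact Finset.sum_congr rfl fun e _ => by ring
    · intro ω
      calc _ ≤ ∏ e, Real.exp (τ ^ 2 / 8 * (w ω e * p e)) := by
            refine Finset.prod_le_prod (fun e _ => ?_) fun e _ => ?_
            · have := h1 e
              have := h0 e
              have : 0 ≤ 1 - p e := by linarith
              positivity
            · have hs : |τ / 4 * (σ * w ω e)| ≤ 1 := by
                rw [abs_mul, abs_mul, hσ, abs_of_nonneg (hw0 ω e), one_mul,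
                  abs_of_nonneg (by positivity)]
                nlinarith [hw0 ω e, hw2 ω e]
              have hm := bernoulli_mgf_le (h0 e) hs
              simp only [if_true, Bool.false_eq_true, if_false]
              refine hm.trans (Real.exp_le_exp.2 ?_)
              have hσ2 : σ ^ 2 = 1 := by rw [← sq_abs, hσ]; norm_num
              have : p e * (τ / 4 * (σ * w ω e)) ^ 2
                  = τ ^ 2 / 16 * (w ω e * p e) * w ω e := by
                calc _ = p e * (τ ^ 2 / 16 * σ ^ 2 * w ω e ^ 2) := by ring
                  _ = _ := by rw [hσ2]; ring
              rw [this]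
              have hnn : 0 ≤ τ ^ 2 / 16 * (w ω e * p e) := by
                have := h0 e; have := hw0 ω e; positivity
              nlinarith [hw2 ω e]
        _ = Real.exp (τ ^ 2 / 8 * ∑ e, w ω e * p e) := by
            rw [← Real.exp_sum, Finset.mul_sum]
        _ ≤ _ := by
            refine Real.exp_le_exp.2 ?_
            have := hμ ω
            have : τ ^ 2 / 8 * ∑ e, w ω e * p e ≤ τ ^ 2 / 8 * μ := by gcongr
            linarith
  have hpt : ∀ ω, (B ∩ {ω | τ * μ < |Z ω|}).indicator (bernMass p) ω ≤
      Real.exp (-(τ / 4 * (τ * μ))) *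
        (bernMass p ω * (B.indicator 1 ω * Real.exp (τ / 4 * (1 * Z ω)))
          + bernMass p ω * (B.indicator 1 ω * Real.exp (τ / 4 * (-1 * Z ω)))) := by
    intro ω
    have hm := bernMass_nonneg h0 h1 ω
    by_cases hω : ω ∈ B ∩ {ω | τ * μ < |Z ω|}
    · rw [Set.indicator_of_mem hω, Set.indicator_of_mem hω.1, Pi.one_apply]
      have hdev : τ * μ < |Z ω| := hω.2
      have : 1 ≤ Real.exp (-(τ / 4 * (τ * μ))) *
          (Real.exp (τ / 4 * (1 * Z ω)) + Real.exp (τ / 4 * (-1 * Z ω))) := by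
        rw [mul_add, ← Real.exp_add, ← Real.exp_add]
        rcases abs_cases (Z ω) with ⟨h, _⟩ | ⟨h, _⟩
        · have : 1 ≤ Real.exp (-(τ / 4 * (τ * μ)) + τ / 4 * (1 * Z ω)) :=
            Real.one_le_exp (by nlinarith)
          linarith [Real.exp_pos (-(τ / 4 * (τ * μ)) + τ / 4 * (-1 * Z ω))]
        · have : 1 ≤ Real.exp (-(τ / 4 * (τ * μ)) + τ / 4 * (-1 * Z ω)) :=
            Real.one_le_exp (by nlinarith)
          linarith [Real.exp_pos (-(τ / 4 * (τ * μ)) + τ / 4 * (1 * Z ω))]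
      nlinarith [mul_le_mul_of_nonneg_left this hm]
    · rw [Set.indicator_of_notMem hω]
      have : 0 ≤ B.indicator (1 : (ι → Bool) → ℝ) ω :=
        Set.indicator_nonneg (fun _ _ => zero_le_one) _
      positivity
  calc _ ≤ ∑ ω, _ := Finset.sum_le_sum fun ω _ => hpt ω
    _ ≤ Real.exp (-(τ / 4 * (τ * μ))) * (bernProb p B * Real.exp (τ ^ 2 * μ / 8)
          + bernProb p B * Real.exp (τ ^ 2 * μ / 8)) := by
        rw [← Finset.mul_sum, Finset.sum_add_distrib]
        gcongr
        · exact key 1 (by simp)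
        · exact key (-1) (by simp)
    _ = bernProb p B * (2 * (Real.exp (-(τ / 4 * (τ * μ))) * Real.exp (τ ^ 2 * μ / 8))) := by ring
    _ = _ := by
        rw [← Real.exp_add]
        congr 3
        ring

/-- The geometric mean dominates the harmonic mean, which is the arithmetic mean minus `(a - b)² /
(2 (a + b))`. Apply this to `(p, q)` and `(1 - p, 1 - q)`; since `p, q ≤ 1/2`, the second deficit is
at most the first. -/
theorem one_sub_le_bhattacharyya {p q : ℝ} (hp : 0 < p) (hq : 0 < q) (hp' : p ≤ 1 / 2)
    (hq' : q ≤ 1 / 2) :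
    1 - (p - q) ^ 2 / (p + q) ≤ √(p * q) + √((1 - p) * (1 - q)) := by
  have hgm : ∀ a b : ℝ, 0 < a → 0 < b → (a + b) / 2 - (a - b) ^ 2 / (2 * (a + b)) ≤ √(a * b) := by
    intro a b ha hb
    have : (a + b) / 2 - (a - b) ^ 2 / (2 * (a + b)) = 2 * (a * b) / (a + b) := by
      field_simp; ring
    rw [this, div_le_iff₀ (by positivity)]
    have h1 : √(a * b) ^ 2 = a * b := Real.sq_sqrt (by positivity)
    have h2 : 2 * √(a * b) ≤ a + b := by
      rw [Real.sqrt_mul ha.le]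
      nlinarith [sq_nonneg (√a - √b), Real.sq_sqrt ha.le, Real.sq_sqrt hb.le]
    nlinarith [Real.sqrt_nonneg (a * b)]
  have h1 := hgm p q hp hq
  have h2 := hgm (1 - p) (1 - q) (by linarith) (by linarith)
  have h3 : ((1 - p) - (1 - q)) ^ 2 / (2 * ((1 - p) + (1 - q))) ≤ (p - q) ^ 2 / (2 * (p + q)) := by
    rw [show ((1 - p) - (1 - q)) ^ 2 = (p - q) ^ 2 by ring]
    refine div_le_div_of_nonneg_left (sq_nonneg _) (by positivity) ?_
    linarith
  have h4 : (p - q) ^ 2 / (p + q) = 2 * ((p - q) ^ 2 / (2 * (p + q))) := by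
    field_simp
  linarith

/-- The exponential form makes the bound multiply over edges. It follows from `exp (-2x) ≤ 1 - x` on
`[0, 1/2]`, where `x = (p - q)² / (p + q)` lies because `p, q ≤ 1/2`. -/
theorem exp_le_bhattacharyya {p q : ℝ} (hp : 0 < p) (hq : 0 < q) (hp' : p ≤ 1 / 2)
    (hq' : q ≤ 1 / 2) :
    Real.exp (-(2 * ((p - q) ^ 2 / (p + q)))) ≤ √(p * q) + √((1 - p) * (1 - q)) := by
  refine le_trans ?_ (one_sub_le_bhattacharyya hp hq hp' hq')
  set x := (p - q) ^ 2 / (p + q) with hx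
  have hx0 : 0 ≤ x := by positivity
  have hx1 : x ≤ 1 / 2 := by
    rw [hx, div_le_iff₀ (by positivity)]
    nlinarith [abs_le.1 (abs_sub_le_of_nonneg_of_le hp.le hp' hq.le hq')]
  rw [Real.exp_neg, inv_le_comm₀ (Real.exp_pos _) (by linarith)]
  have : (1 - x)⁻¹ ≤ 2 * x + 1 := by
    rw [inv_le_iff_one_le_mul₀ (by linarith)]
    nlinarith
  exact this.trans (Real.add_one_le_exp _)

/-- Two-point lower bound: the sum of the two error probabilities of a test is at least half the
squared Bhattacharyya coefficient. -/
theorem sq_bhattacharyya_le_bernProb_add {p q : ι → ℝ} (hp0 : ∀ e, 0 ≤ p e) (hp1 : ∀ e, p e ≤ 1)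
    (hq0 : ∀ e, 0 ≤ q e) (hq1 : ∀ e, q e ≤ 1) {S T : Set (ι → Bool)} (hST : S ∪ T = Set.univ) :
    (∏ e, (√(p e * q e) + √((1 - p e) * (1 - q e)))) ^ 2 ≤
      2 * (bernProb p S + bernProb q T) := by
  set f := bernMass p
  set g := bernMass q
  have hf : ∀ ω, 0 ≤ f ω := bernMass_nonneg hp0 hp1
  have hg : ∀ ω, 0 ≤ g ω := bernMass_nonneg hq0 hq1
  -- Writing `√(f g) = √(min f g) √(max f g)` prepares Cauchy-Schwarz: the minima sum to at most the
  -- two errors, the maxima to at most `2`.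
  have hprod : ∏ e, (√(p e * q e) + √((1 - p e) * (1 - q e)))
      = ∑ ω, √(min (f ω) (g ω)) * √(max (f ω) (g ω)) := by
    have := sum_prod_bool fun e b => if b = true then √(p e * q e) else √((1 - p e) * (1 - q e))
    simp only [if_true, Bool.false_eq_true, if_false] at this
    rw [← this]
    refine Finset.sum_congr rfl fun ω _ => ?_
    rw [← Real.sqrt_mul (le_min (hf ω) (hg ω)), min_mul_max]
    simp only [f, g, bernMass]
    rw [← Finset.prod_mul_distrib, Real.sqrt_prod]
    · refine Finset.prod_congr rfl fun e _ => ?_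
      split_ifs <;> rfl
    · intro e _
      have := hp0 e; have := hq0 e
      have : 0 ≤ 1 - p e := by linarith [hp1 e]
      have : 0 ≤ 1 - q e := by linarith [hq1 e]
      split_ifs <;> positivity
  rw [hprod]
  have hCS := Finset.sum_mul_sq_le_sq_mul_sq Finset.univ (fun ω => √(min (f ω) (g ω)))
    fun ω => √(max (f ω) (g ω))
  have h1 : ∑ ω, √(min (f ω) (g ω)) ^ 2 ≤ bernProb p S + bernProb q T := by
    rw [bernProb, bernProb, ← Finset.sum_add_distrib]
    refine Finset.sum_le_sum fun ω _ => ?_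
    rw [Real.sq_sqrt (le_min (hf ω) (hg ω))]
    have hSn : 0 ≤ S.indicator f ω := Set.indicator_nonneg (fun _ _ => hf _) _
    have hTn : 0 ≤ T.indicator g ω := Set.indicator_nonneg (fun _ _ => hg _) _
    rcases (hST ▸ Set.mem_univ ω : ω ∈ S ∪ T) with h | h
    · rw [Set.indicator_of_mem h] at *
      exact (min_le_left _ _).trans (by linarith)
    · rw [Set.indicator_of_mem h] at *
      exact (min_le_right _ _).trans (by linarith)
  have h2 : ∑ ω, √(max (f ω) (g ω)) ^ 2 ≤ 2 := by
    calc _ ≤ ∑ ω, (f ω + g ω) := by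
          refine Finset.sum_le_sum fun ω _ => ?_
          rw [Real.sq_sqrt (le_max_of_le_left (hf ω))]
          exact max_le (by linarith [hg ω]) (by linarith [hf ω])
      _ = 2 := by
          rw [Finset.sum_add_distrib, sum_bernMass, sum_bernMass]
          norm_num
  have h3 : 0 ≤ ∑ ω, √(min (f ω) (g ω)) ^ 2 := Finset.sum_nonneg fun _ _ => sq_nonneg _
  nlinarith

end BernoulliProduct

/-! ### Stability of angle comparisons under perturbation. -/

section Geometry

variable {V : Type*} [NormedAddCommGroup V] [InnerProductSpace ℝ V]

open InnerProductGeometry in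
/-- If `v` makes a smaller angle with `a` than `u` does, then the ray of `v` comes at least as
close to `a` as `u`. -/
theorem exists_norm_sub_smul_le {a u v : V} (ha : a ≠ 0) (hu : u ≠ 0) (hv : v ≠ 0)
    (h : angle v a ≤ angle u a) (hpos : 0 ≤ inner ℝ u a) :
    ∃ t : ℝ, 0 ≤ t ∧ ‖a - t • v‖ ≤ ‖a - u‖ ∧ t * ‖v‖ ≤ ‖a‖ := by
  have ha' := norm_pos_iff.2 ha
  have hu' := norm_pos_iff.2 hu
  have hv' := norm_pos_iff.2 hv
  have hcos : Real.cos (angle u a) ≤ Real.cos (angle v a) :=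
    Real.cos_le_cos_of_nonneg_of_le_pi (angle_nonneg _ _) (angle_le_pi _ _) h
  rw [cos_angle, cos_angle, ← div_div, ← div_div, div_le_div_iff_of_pos_right ha'] at hcos
  set x : ℝ := inner ℝ u a with hx
  set z : ℝ := inner ℝ v a with hz
  have hx0 : 0 ≤ x / ‖u‖ := by positivity
  have hz0 : 0 ≤ z / ‖v‖ := hx0.trans hcos
  have hsq : (x / ‖u‖) ^ 2 ≤ (z / ‖v‖) ^ 2 := pow_le_pow_left₀ hx0 hcos 2
  -- The coefficient `⟨v, a⟩ / ‖v‖²` of the orthogonal projection of `a` onto the line of `v`.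
  refine ⟨z / ‖v‖ / ‖v‖, by positivity, ?_, ?_⟩
  · refine le_of_sq_le_sq ?_ (norm_nonneg _)
    have e1 : ‖a - (z / ‖v‖ / ‖v‖) • v‖ ^ 2 = ‖a‖ ^ 2 - (z / ‖v‖) ^ 2 := by
      rw [norm_sub_sq_real, inner_smul_right, real_inner_comm, ← hz, norm_smul, mul_pow,
        Real.norm_eq_abs, sq_abs]
      field_simp
      ring
    have e2 : ‖a‖ ^ 2 - (x / ‖u‖) ^ 2 ≤ ‖a - u‖ ^ 2 := by
      rw [norm_sub_sq_real, real_inner_comm, ← hx]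
      have : x = x / ‖u‖ * ‖u‖ := by field_simp
      nlinarith [sq_nonneg (x / ‖u‖ - ‖u‖)]
    linarith
  · rw [div_mul_cancel₀ _ hv'.ne', div_le_iff₀ hv', mul_comm]
    exact real_inner_le_norm v a

open InnerProductGeometry in
/-- If `u` and `a` are close to `b`, and `v` is close to `b'`, where the line of `b'` stays away
from `b`, then `a` makes a smaller angle with `u` than with `v`. -/
theorem angle_lt_angle_of_close {a u v b b' : V} {ρ N B Γ : ℝ} (hN : 0 < N) (hρN : 4 * ρ ≤ N)
    (ha : ‖a - b‖ ≤ ρ) (hu : ‖u - b‖ ≤ ρ) (hv : ‖v - b'‖ ≤ ρ) (hb : N ≤ ‖b‖) (hb' : N ≤ ‖b'‖)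
    (hB : ‖b‖ ≤ B) (hΓ : ∀ t : ℝ, Γ ≤ ‖b - t • b'‖) (h : ρ * (3 + 2 * (B + N) / N) < Γ) :
    angle u a < angle v a := by
  by_contra! hcon
  have hρ : 0 ≤ ρ := (norm_nonneg _).trans ha
  have low : ∀ {x y : V}, ‖x - y‖ ≤ ρ → N ≤ ‖y‖ → N - ρ ≤ ‖x‖ := fun {x y} h1 h2 => by
    have := norm_sub_norm_le y x
    rw [norm_sub_rev] at this
    linarith
  have la := low ha hb
  have lu := low hu hb
  have lv := low hv hb'
  have hua : ‖u - a‖ ≤ 2 * ρ := by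
    calc ‖u - a‖ = ‖(u - b) - (a - b)‖ := by congr 1; abel
      _ ≤ _ := by linarith [norm_sub_le (u - b) (a - b)]
  -- `u` lies within `2ρ` of `a`, while `‖a‖ ≥ N - ρ ≥ 3ρ`.
  have hpos : 0 ≤ inner ℝ u a := by
    have e : inner ℝ u a = ‖a‖ ^ 2 + inner ℝ (u - a) a := by
      rw [inner_sub_left, real_inner_self_eq_norm_sq]; ring
    have := abs_le.1 (abs_real_inner_le_norm (u - a) a)
    nlinarith [norm_nonneg a]
  obtain ⟨t, ht0, ht1, ht2⟩ := exists_norm_sub_smul_le (norm_pos_iff.1 (by linarith))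
    (norm_pos_iff.1 (by linarith)) (norm_pos_iff.1 (by linarith)) hcon hpos
  have ub : ‖a‖ ≤ B + N := by
    have := norm_sub_norm_le a b
    linarith
  -- Here `‖v‖ ≥ N - ρ ≥ N / 2`; this bounds the factor by which the error `v - b'` is amplified.
  have ht : t ≤ 2 * (B + N) / N := by
    rw [le_div_iff₀ hN]
    nlinarith
  have : ‖b - t • b'‖ ≤ ρ * (3 + 2 * (B + N) / N) := by
    calc ‖b - t • b'‖ = ‖(b - a) + (a - t • v) + t • (v - b')‖ := by
          congr 1; rw [smul_sub]; abel
      _ ≤ ‖b - a‖ + ‖a - t • v‖ + ‖t • (v - b')‖ := norm_add₃_le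
      _ ≤ ρ + 2 * ρ + t * ρ := by
          rw [norm_smul, Real.norm_eq_abs, abs_of_nonneg ht0, norm_sub_rev b a]
          gcongr
          rw [norm_sub_rev a u] at ht1
          linarith
      _ ≤ _ := by nlinarith
  linarith [hΓ t]

end Geometry

/-! ### Norm comparisons and the separation of the rows of `P`. -/

theorem euclidean_norm_le_sum {ι : Type*} [Fintype ι] (v : EuclideanSpace ℝ ι) :
    ‖v‖ ≤ ∑ s, |v s| := by
  rw [EuclideanSpace.norm_eq]
  refine Real.sqrt_le_iff.2 ⟨Finset.sum_nonneg fun _ _ => abs_nonneg _, ?_⟩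
  exact Finset.sum_sq_le_sq_sum_of_nonneg fun _ _ => abs_nonneg _

theorem euclidean_norm_le_card_mul {ι : Type*} [Fintype ι] (v : EuclideanSpace ℝ ι) {ρ : ℝ}
    (h : ∀ s, |v s| ≤ ρ) : ‖v‖ ≤ Fintype.card ι * ρ := by
  refine (euclidean_norm_le_sum v).trans ?_
  simpa using Finset.sum_le_card_nsmul Finset.univ (fun s => |v s|) ρ fun s _ => h s

theorem abs_apply_le_euclidean_norm {ι : Type*} [Fintype ι] (v : EuclideanSpace ℝ ι) (s : ι) :
    |v s| ≤ ‖v‖ := by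
  simpa using PiLp.norm_apply_le v s

/-- A symmetric matrix with eigenvalues at least `β` in magnitude expands norms by `β`. -/
theorem le_norm_mulVec {ι : Type*} [Fintype ι] [DecidableEq ι] {P : Matrix ι ι ℝ} (hP : P.IsSymm)
    {β : ℝ} (hβ : 0 ≤ β)
    (h : ∀ μ : ℝ, Module.End.HasEigenvalue (Matrix.toLin' P) μ → β ≤ |μ|) (x : ι → ℝ) :
    β * ‖(WithLp.toLp 2 x : EuclideanSpace ℝ ι)‖
      ≤ ‖(WithLp.toLp 2 (P.mulVec x) : EuclideanSpace ℝ ι)‖ := by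
  have hH : P.IsHermitian := by
    rw [Matrix.IsHermitian, Matrix.conjTranspose_eq_transpose_of_trivial]
    exact hP
  have hsymm := Matrix.isSymmetric_toEuclideanLin_iff.2 hH
  set b := hH.eigenvectorBasis
  have hev : ∀ j, β ≤ |hH.eigenvalues j| := fun j => by
    refine h _ (Module.End.hasEigenvalue_of_hasEigenvector (x := (b j).ofLp) ⟨?_, ?_⟩)
    · rw [Module.End.mem_eigenspace_iff, Matrix.toLin'_apply]
      exact hH.mulVec_eigenvectorBasis j
    · intro h0
      exact b.orthonormal.ne_zero j (by ext s; simpa using congrFun h0 s)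
  have hin : ∀ j, inner ℝ (b j) (WithLp.toLp 2 (P.mulVec x) : EuclideanSpace ℝ ι)
      = hH.eigenvalues j * inner ℝ (b j) (WithLp.toLp 2 x : EuclideanSpace ℝ ι) := fun j => by
    have h1 := hsymm (b j) (WithLp.toLp 2 x)
    have h2 : Matrix.toEuclideanLin P (b j) = hH.eigenvalues j • b j := by
      ext s
      simpa using congrFun (hH.mulVec_eigenvectorBasis j) s
    rw [h2, real_inner_smul_left] at h1
    rw [h1]
    rfl
  refine le_of_sq_le_sq ?_ (norm_nonneg _)
  rw [mul_pow, ← b.sum_sq_norm_inner_right, ← b.sum_sq_norm_inner_right, Finset.mul_sum]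
  refine Finset.sum_le_sum fun j _ => ?_
  rw [hin, norm_mul, mul_pow, Real.norm_eq_abs (hH.eigenvalues j)]
  gcongr
  exact hev j

section Rows

variable {n K : ℕ}

/-- Apply the expansion property to `e_k - e_l`, which `P` sends to a difference of columns, hence
of rows by symmetry. This is how the eigenvalue bound enters the proof. -/
theorem beta_le_card_mul_norm_sub {M : Params n K} {C₁ β : ℝ} (hP : M.P.IsSymm) (hβ : 0 ≤ β)
    (h : M.CondP C₁ β) {k l : Fin K} (hkl : k ≠ l) : β ≤ K * ‖M.P k - M.P l‖ := by
  have h1 := le_norm_mulVec hP hβ h.2 (Pi.single k 1 - Pi.single l 1)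
  have h2 : (1 : ℝ) ≤ ‖(WithLp.toLp 2 (Pi.single k 1 - Pi.single l 1) : EuclideanSpace ℝ (Fin K))‖ := by
    have := abs_apply_le_euclidean_norm
      (WithLp.toLp 2 (Pi.single k 1 - Pi.single l 1) : EuclideanSpace ℝ (Fin K)) k
    simpa [hkl] using this
  have h3 := euclidean_norm_le_card_mul (ρ := ‖M.P k - M.P l‖)
    (WithLp.toLp 2 (M.P.mulVec (Pi.single k 1 - Pi.single l 1)) : EuclideanSpace ℝ (Fin K))
    fun s => by
      have := norm_le_pi_norm (M.P k - M.P l) s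
      rw [Real.norm_eq_abs] at this
      simpa [Matrix.mulVec_sub, hP.apply] using this
  rw [Fintype.card_fin] at h3
  nlinarith

/-- Angles ignore scale, so rows must differ as rays. With `a = P k l` and `η` the distance on the
right, the coordinates `k` and `l` give `|1 - t a| ≤ η` and `|a - t| ≤ η`; as `a ≥ 0`, this forces
`|t - 1| ≤ 2η`. -/
theorem norm_sub_le_mul_norm_sub_smul {P : Matrix (Fin K) (Fin K) ℝ} {C₁ : ℝ} (hP : P.IsSymm)
    (hd : ∀ k, P k k = 1) (h0 : ∀ k l, 0 ≤ P k l) (hC : ∀ k l, |P k l| ≤ C₁) (k l : Fin K) (t : ℝ) :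
    ‖P k - P l‖ ≤ (1 + 2 * C₁) * ‖P k - t • P l‖ := by
  have hC₁ : 0 ≤ C₁ := (abs_nonneg _).trans (hC k k)
  set η := ‖P k - t • P l‖
  have h1 := norm_le_pi_norm (P k - t • P l) k
  have h2 := norm_le_pi_norm (P k - t • P l) l
  rw [Real.norm_eq_abs] at h1 h2
  simp only [Pi.sub_apply, Pi.smul_apply, hd, smul_eq_mul, mul_one, hP.apply k l] at h1 h2
  have ha := h0 k l
  have ht : |t - 1| ≤ 2 * η := by
    rw [abs_le] at *
    constructor
    · by_contra! hc
      nlinarith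
    · by_contra! hc
      nlinarith
  have hl : ‖P l‖ ≤ C₁ := (pi_norm_le_iff_of_nonneg hC₁).2 fun m => hC l m
  calc ‖P k - P l‖ = ‖(P k - t • P l) + (t - 1) • P l‖ := by
        congr 1; rw [sub_smul, one_smul]; abel
    _ ≤ η + |t - 1| * ‖P l‖ := by
        refine (norm_add_le _ _).trans ?_
        rw [norm_smul, Real.norm_eq_abs]
    _ ≤ η + 2 * η * C₁ := by gcongr
    _ = _ := by ring

end Rows

/-! ### The network law, relabeling of a node, and the testing lower bound. -/

section Model

variable {n K : ℕ}

/-- The edge probabilities, indexed by the unordered pairs of nodes. -/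
def edgeProb (M : Params n K) (e : Pair n) : ℝ := M.Omega e.1.1 e.1.2

theorem law_singleton {M : Params n K} (h0 : ∀ e, 0 ≤ edgeProb M e) (h1 : ∀ e, edgeProb M e ≤ 1)
    (ω : Config n) : M.law.real {ω} = bernMass (edgeProb M) ω := by
  unfold Params.law
  rw [measureReal_def, Measure.pi_singleton, ENNReal.toReal_prod, bernMass]
  refine Finset.prod_congr rfl fun e _ => ?_
  classical
  rw [← measureReal_def, bernoulliMeasure_real_apply _ (measurableSet_singleton _)]
  have hproj : ∀ x : ℝ, 0 ≤ x → x ≤ 1 → (Set.projIcc (0 : ℝ) 1 zero_le_one x : ℝ) = x :=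
    fun x hx0 hx1 => by rw [Set.projIcc_of_mem zero_le_one ⟨hx0, hx1⟩]
  have e1 := hproj _ (h0 e) (h1 e)
  have e2 := hproj (1 - edgeProb M e) (by linarith [h1 e]) (by linarith [h0 e])
  unfold edgeProb at *
  cases ω e <;> simp [e1, e2]

instance (M : Params n K) : IsProbabilityMeasure M.law := by
  unfold Params.law; infer_instance

theorem law_real {M : Params n K} (h0 : ∀ e, 0 ≤ edgeProb M e) (h1 : ∀ e, edgeProb M e ≤ 1)
    (S : Set (Config n)) : M.law.real S = bernProb (edgeProb M) S := by
  classical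
  have : S = ((Finset.univ.filter (· ∈ S) : Finset (Config n)) : Set (Config n)) := by
    ext; simp
  conv_lhs => rw [this]
  rw [← sum_measureReal_singleton, Finset.sum_filter, bernProb]
  refine Finset.sum_congr rfl fun ω _ => ?_
  rw [law_singleton h0 h1, Set.indicator_apply]

/-- Only unordered pairs carry independent variables, so sums over ordered pairs are folded and
their diagonal is set apart. -/
theorem sum_pair (F : Fin n → Fin n → ℝ) :
    ∑ i, ∑ j, F i j = ∑ e : Pair n, (F e.1.1 e.1.2 + F e.1.2 e.1.1) + ∑ i, F i i := by
  have h1 : ∀ G : Fin n × Fin n → ℝ, ∑ e : Pair n, G e.1 = ∑ x, if x.1 < x.2 then G x else 0 :=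
    fun G => by
      rw [← Finset.sum_filter]
      exact (Finset.sum_subtype (p := fun x : Fin n × Fin n => x.1 < x.2) _ (by simp) G).symm
  rw [Finset.sum_add_distrib, h1 fun x => F x.1 x.2, h1 fun x => F x.2 x.1,
    Fintype.sum_prod_type, Fintype.sum_prod_type]
  conv_rhs => enter [1, 2]; rw [Finset.sum_comm]
  rw [← Finset.sum_add_distrib, ← Finset.sum_add_distrib]
  refine Finset.sum_congr rfl fun i _ => ?_
  rw [← Finset.sum_add_distrib]
  have : F i i = ∑ j, if i = j then F i j else 0 := by simp
  rw [this, ← Finset.sum_add_distrib]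
  refine Finset.sum_congr rfl fun j _ => ?_
  rcases lt_trichotomy i j with h | h | h
  · simp [h, h.not_gt, h.ne]
  · simp [h]
  · simp [h, h.not_gt, h.ne']

theorem adjacency_symm (ω : Config n) (i j : Fin n) : adjacency ω i j = adjacency ω j i := by
  unfold adjacency
  rcases lt_trichotomy i j with h | h | h
  · simp [h, h.not_gt]
  · simp [h]
  · simp [h, h.not_gt]

theorem adjacency_self (ω : Config n) (i : Fin n) : adjacency ω i i = 0 := by
  simp [adjacency]

theorem adjacency_pair (ω : Config n) (e : Pair n) :
    adjacency ω e.1.1 e.1.2 = if ω e = true then 1 else 0 := by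
  have h : e.1.1 < e.1.2 := e.2
  simp [adjacency, h]

theorem adjacency_congr {ω ω' : Config n} {S : Finset (Fin n)}
    (h : ∀ e : Pair n, e.1.1 ∈ S ∧ e.1.2 ∈ S → ω e = ω' e) {i j : Fin n} (hi : i ∈ S) (hj : j ∈ S) :
    adjacency ω i j = adjacency ω' i j := by
  unfold adjacency
  split_ifs with h1 h2 h3 h4 h5 h6 h7 <;> simp_all

namespace Params

variable {M : Params n K}

theorem relabel_Omega_of_ne (i : Fin n) (k : Fin K) {u v : Fin n} (hu : u ≠ i) (hv : v ≠ i) :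
    (M.relabel i k).Omega u v = M.Omega u v := by
  simp [Omega, relabel, hu, hv]

theorem relabel_Omega_left (i : Fin n) (k : Fin K) {v : Fin n} (hv : v ≠ i) :
    (M.relabel i k).Omega i v = M.theta i * M.theta v * M.P k (M.label v) := by
  simp [Omega, relabel, hv]

theorem relabel_Omega_right (i : Fin n) (k : Fin K) {v : Fin n} (hv : v ≠ i) :
    (M.relabel i k).Omega v i = M.theta v * M.theta i * M.P (M.label v) k := by
  simp [Omega, relabel, hv]

theorem Omega_symm (hP : M.P.IsSymm) (u v : Fin n) : M.Omega u v = M.Omega v u := by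
  simp only [Omega]
  rw [hP.apply (M.label v) (M.label u)]
  ring

theorem relabel_Omega_self (hM : M.IsDCBM) (i : Fin n) (k : Fin K) (u : Fin n) :
    (M.relabel i k).Omega u u = M.theta u ^ 2 := by
  simp [Omega, relabel, hM.P_diag, sq]

theorem relabel_Omega_nonneg (hM : M.IsDCBM) (i : Fin n) (k : Fin K) (u v : Fin n) :
    0 ≤ (M.relabel i k).Omega u v :=
  mul_nonneg (mul_nonneg (hM.theta_pos u).le (hM.theta_pos v).le) (hM.P_nonneg _ _)

theorem l1_eq (hM : M.IsDCBM) (S : Finset (Fin n)) : M.l1 S = ∑ j ∈ S, M.theta j :=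
  Finset.sum_congr rfl fun j _ => abs_of_pos (hM.theta_pos j)

theorem l1_nonneg (M : Params n K) (S : Finset (Fin n)) : 0 ≤ M.l1 S :=
  Finset.sum_nonneg fun _ _ => abs_nonneg _

theorem theta_le_l1 (hM : M.IsDCBM) {S : Finset (Fin n)} {i : Fin n} (hi : i ∈ S) :
    M.theta i ≤ M.l1 S := by
  rw [l1_eq hM]
  exact Finset.single_le_sum (fun j _ => (hM.theta_pos j).le) hi

variable {C₁ : ℝ} {i : Fin n}

theorem theta_mul_le_half (hM : M.IsDCBM) (hC : ∀ k l, |M.P k l| ≤ C₁)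
    (hi : 2 * C₁ * M.theta i ≤ 1) (v : Fin n) (k l : Fin K) :
    M.theta i * M.theta v * M.P k l ≤ 1 / 2 := by
  have h1 := hM.theta_pos i
  have h2 := hM.theta_pos v
  have h3 := hM.theta_le_one v
  have h4 := (le_abs_self _).trans (hC k l)
  have h5 := hM.P_nonneg k l
  calc _ ≤ M.theta i * 1 * C₁ := by gcongr
    _ ≤ _ := by linarith

theorem edgeProb_relabel_nonneg (hM : M.IsDCBM) (i : Fin n) (k : Fin K) (e : Pair n) :
    0 ≤ edgeProb (M.relabel i k) e :=
  relabel_Omega_nonneg hM i k _ _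

theorem edgeProb_relabel_le_one (hM : M.IsDCBM) (hC : ∀ k l, |M.P k l| ≤ C₁)
    (hi : 2 * C₁ * M.theta i ≤ 1) (k : Fin K) (e : Pair n) : edgeProb (M.relabel i k) e ≤ 1 := by
  have hne : e.1.1 ≠ e.1.2 := ne_of_lt e.2
  unfold edgeProb
  by_cases h1 : e.1.1 = i
  · rw [h1, relabel_Omega_left i k (h1 ▸ hne.symm)]
    linarith [theta_mul_le_half hM hC hi e.1.2 k (M.label e.1.2)]
  · by_cases h2 : e.1.2 = i
    · rw [h2, relabel_Omega_right i k h1, mul_comm (M.theta _)]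
      linarith [theta_mul_le_half hM hC hi e.1.1 (M.label e.1.1) k]
    · rw [relabel_Omega_of_ne i k h1 h2]
      exact hM.Omega_le_one _ _ hne

theorem edgeProb_relabel_of_ne (i : Fin n) (k l : Fin K) {e : Pair n} (h1 : e.1.1 ≠ i)
    (h2 : e.1.2 ≠ i) : edgeProb (M.relabel i k) e = edgeProb (M.relabel i l) e := by
  unfold edgeProb
  rw [relabel_Omega_of_ne i k h1 h2, relabel_Omega_of_ne i l h1 h2]

theorem relabel_label (M : Params n K) (i : Fin n) : M.relabel i (M.label i) = M := by
  simp [relabel]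

/-- The edges at `i` have the probabilities `θ_i θ_v P_{k, π_v}`. -/
theorem exists_edgeProb_relabel_eq (hP : M.P.IsSymm) {e : Pair n} (h : e.1.1 = i ∨ e.1.2 = i) :
    ∃ v, v ≠ i ∧ (∀ k, edgeProb (M.relabel i k) e = M.theta i * M.theta v * M.P k (M.label v)) ∧
      ((if e.1.1 ∈ ({i} : Finset (Fin n)) then 1 else 0) * M.theta e.1.2 +
        (if e.1.2 ∈ ({i} : Finset (Fin n)) then 1 else 0) * M.theta e.1.1) = M.theta v := by
  have hne : e.1.1 ≠ e.1.2 := ne_of_lt e.2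
  rcases h with h | h
  · refine ⟨e.1.2, h ▸ hne.symm, fun k => ?_, ?_⟩
    · rw [edgeProb, h, relabel_Omega_left i k (h ▸ hne.symm)]
    · simp [h, (h ▸ hne.symm : e.1.2 ≠ i)]
  · refine ⟨e.1.1, h ▸ hne, fun k => ?_, ?_⟩
    · rw [edgeProb, h, relabel_Omega_right i k (h ▸ hne), hP.apply k]
      ring
    · simp [h, (h ▸ hne : e.1.1 ≠ i)]

/-- Any test between two labels of node `i` has errors of this size. -/
theorem exp_le_law_add_law (hM : M.IsDCBM) (hC : ∀ k l, |M.P k l| ≤ C₁)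
    (hi : 2 * C₁ * M.theta i ≤ 1) {r : ℝ} (hr0 : 0 < r) (hr : ∀ k l, r ≤ M.P k l) (k l : Fin K)
    {S T : Set (Config n)} (hST : S ∪ T = Set.univ) :
    Real.exp (-(2 / r * (‖M.P k - M.P l‖ ^ 2 * M.theta i * M.l1 Finset.univ))) / 2 ≤
      (M.relabel i k).law.real S + (M.relabel i l).law.real T := by
  have p0 := fun k => edgeProb_relabel_nonneg hM i k
  have p1 := fun k => edgeProb_relabel_le_one hM hC hi k
  rw [law_real (p0 k) (p1 k), law_real (p0 l) (p1 l), div_le_iff₀ two_pos, mul_comm _ (2 : ℝ)]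
  refine le_trans ?_ (sq_bhattacharyya_le_bernProb_add (p0 k) (p1 k) (p0 l) (p1 l) hST)
  set δ := ‖M.P k - M.P l‖
  -- On an edge at `i` this is the degree parameter of the other endpoint, and elsewhere it
  -- vanishes. The indicator form lets `sum_pair` show that the total is at most `‖θ‖₁`.
  set t : Pair n → ℝ := fun e => (if e.1.1 ∈ ({i} : Finset (Fin n)) then 1 else 0) * M.theta e.1.2 +
        (if e.1.2 ∈ ({i} : Finset (Fin n)) then 1 else 0) * M.theta e.1.1 with ht
  have hedge : ∀ e, Real.exp (-(δ ^ 2 * M.theta i / r * t e)) ≤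
      √(edgeProb (M.relabel i k) e * edgeProb (M.relabel i l) e) +
        √((1 - edgeProb (M.relabel i k) e) * (1 - edgeProb (M.relabel i l) e)) := by
    intro e
    by_cases he : e.1.1 = i ∨ e.1.2 = i
    · obtain ⟨v, -, hv1, hv2⟩ := exists_edgeProb_relabel_eq hM.P_symm he
      have hθ := mul_pos (hM.theta_pos i) (hM.theta_pos v)
      have hpk := hr0.trans_le (hr k (M.label v))
      have hpl := hr0.trans_le (hr l (M.label v))
      refine le_trans (Real.exp_le_exp.2 (neg_le_neg ?_)) (exp_le_bhattacharyya
        (by rw [hv1]; positivity) (by rw [hv1]; positivity)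
        (by rw [hv1]; exact theta_mul_le_half hM hC hi _ _ _)
        (by rw [hv1]; exact theta_mul_le_half hM hC hi _ _ _))
      rw [hv1, hv1, ht]
      simp only [hv2]
      set θ := M.theta i * M.theta v with hθdef
      set a := M.P k (M.label v)
      set b := M.P l (M.label v)
      have hab : (a - b) ^ 2 ≤ δ ^ 2 := by
        have := norm_le_pi_norm (M.P k - M.P l) (M.label v)
        rw [← sq_abs (a - b)]
        exact pow_le_pow_left₀ (abs_nonneg _) this 2
      have h2r : 2 * r ≤ a + b := by linarith [hr k (M.label v), hr l (M.label v)]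
      calc 2 * ((θ * a - θ * b) ^ 2 / (θ * a + θ * b)) = 2 * (θ * ((a - b) ^ 2 / (a + b))) := by
            field_simp
        _ ≤ 2 * (θ * (δ ^ 2 / (2 * r))) := by gcongr
        _ = _ := by rw [hθdef]; field_simp
    · push Not at he
      rw [edgeProb_relabel_of_ne i k l he.1 he.2]
      have h0 := p0 l e
      have h1 := p1 l e
      rw [Real.sqrt_mul_self h0, Real.sqrt_mul_self (by linarith)]
      simp [ht, he.1, he.2]
  have hsum : ∑ e, t e ≤ M.l1 Finset.univ := by
    have := sum_pair fun u v => (if u ∈ ({i} : Finset (Fin n)) then 1 else 0) * M.theta v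
    have h2 : ∑ u, (if u ∈ ({i} : Finset (Fin n)) then 1 else 0) * M.theta u = M.theta i := by
      simp
    have h3 : ∑ u, ∑ v, (if u ∈ ({i} : Finset (Fin n)) then 1 else 0) * M.theta v
        = M.l1 Finset.univ := by
      rw [l1_eq hM]; simp
    rw [h2, h3] at this
    linarith [hM.theta_pos i]
  calc _ ≤ Real.exp (-(δ ^ 2 * M.theta i / r * ∑ e, t e)) ^ 2 := by
        rw [← Real.exp_nat_mul]
        refine Real.exp_le_exp.2 ?_
        have := hM.theta_pos i
        have : δ ^ 2 * M.theta i / r * ∑ e, t e ≤ δ ^ 2 * M.theta i / r * M.l1 Finset.univ := by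
          gcongr
        have e : 2 / r * (δ ^ 2 * M.theta i * M.l1 Finset.univ)
          = 2 * (δ ^ 2 * M.theta i / r * M.l1 Finset.univ) := by ring
        rw [e]
        push_cast
        linarith
    _ ≤ _ := by
        refine pow_le_pow_left₀ (Real.exp_pos _).le ?_ 2
        rw [Finset.mul_sum, ← Finset.sum_neg_distrib, Real.exp_sum]
        exact Finset.prod_le_prod (fun _ _ => (Real.exp_pos _).le) fun e _ => hedge e

end Params

end Model

/-! ### The projection of expected connections, and its lower bound. -/

section Features

variable {n K : ℕ}

/-- The weights of the nodes in the coordinates of the projection `f(·; H)`. -/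
def coordWeight (M : Params n K) (L S : Finset (Fin n)) (p : {j // j ∈ S} → Fin K) :
    Fin K ⊕ Fin K → Fin n → ℝ :=
  Sum.elim (fun m j => if j ∈ M.comm L m then 1 else 0)
    (fun m j => if h : j ∈ S then (if p ⟨j, h⟩ = m then 1 else 0) else 0)

variable {M : Params n K} {L S : Finset (Fin n)} {p : {j // j ∈ S} → Fin K}

theorem coordWeight_nonneg (s : Fin K ⊕ Fin K) (j : Fin n) : 0 ≤ coordWeight M L S p s j := by
  rcases s with m | m <;> simp only [coordWeight, Sum.elim_inl, Sum.elim_inr] <;> split_ifs <;>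
    norm_num

theorem coordWeight_le_one (s : Fin K ⊕ Fin K) (j : Fin n) : coordWeight M L S p s j ≤ 1 := by
  rcases s with m | m <;> simp only [coordWeight, Sum.elim_inl, Sum.elim_inr] <;> split_ifs <;>
    norm_num

theorem coordWeight_eq_zero {i : Fin n} (hL : i ∉ L) (hS : i ∉ S) (s : Fin K ⊕ Fin K) :
    coordWeight M L S p s i = 0 := by
  rcases s with m | m <;> simp [coordWeight, Params.comm, hL, hS]

theorem sum_subtype_mul_eq (f : {j // j ∈ S} → ℝ) (x : Fin n → ℝ) :
    ∑ j : {j // j ∈ S}, f j * x j = ∑ j, (if h : j ∈ S then f ⟨j, h⟩ else 0) * x j := by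
  rw [← Finset.sum_subset (Finset.subset_univ S), ← Finset.sum_coe_sort S]
  · exact Finset.sum_congr rfl fun j _ => by simp
  · intro j _ hj
    simp [hj]

theorem feature_apply (x : Fin n → ℝ) (s : Fin K ⊕ Fin K) :
    feature M L S (membership p) x s = ∑ j, coordWeight M L S p s j * x j := by
  rcases s with m | m
  · simp [feature, coordWeight]
  · simp only [feature, coordWeight, membership, Sum.elim_inr]
    rw [← sum_subtype_mul_eq (fun j => if p j = m then (1 : ℝ) else 0)]
    exact Finset.sum_congr rfl fun j _ => mul_comm _ _

/-- The projection of the expected connections of a node with the profile `x`. -/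
def profile (M : Params n K) (L S : Finset (Fin n)) (p : {j // j ∈ S} → Fin K) (x : Fin K → ℝ) :
    EuclideanSpace ℝ (Fin K ⊕ Fin K) :=
  feature M L S (membership p) fun j => M.theta j * x (M.label j)

theorem profile_apply (x : Fin K → ℝ) (s : Fin K ⊕ Fin K) :
    profile M L S p x s = ∑ j, coordWeight M L S p s j * (M.theta j * x (M.label j)) :=
  feature_apply _ _

theorem profile_sub_smul (x z : Fin K → ℝ) (t : ℝ) :
    profile M L S p (x - t • z) = profile M L S p x - t • profile M L S p z := by
  ext s
  simp only [PiLp.sub_apply, PiLp.smul_apply, profile_apply, smul_eq_mul, Finset.mul_sum,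
    ← Finset.sum_sub_distrib, Pi.sub_apply, Pi.smul_apply]
  exact Finset.sum_congr rfl fun j _ => by ring

theorem profile_apply_le (hM : M.IsDCBM) {x : Fin K → ℝ} (hx0 : ∀ m, 0 ≤ x m) {C : ℝ}
    (hx : ∀ m, x m ≤ C) (s : Fin K ⊕ Fin K) :
    0 ≤ profile M L S p x s ∧ profile M L S p x s ≤ C * M.l1 Finset.univ := by
  rw [profile_apply, Params.l1_eq hM, Finset.mul_sum]
  constructor
  · exact Finset.sum_nonneg fun j _ =>
      mul_nonneg (coordWeight_nonneg _ _) (mul_nonneg (hM.theta_pos j).le (hx0 _))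
  · refine Finset.sum_le_sum fun j _ => ?_
    have := hM.theta_pos j
    have := hx0 (M.label j)
    calc _ ≤ 1 * (M.theta j * x (M.label j)) := by
          gcongr
          exact coordWeight_le_one _ _
      _ ≤ 1 * (M.theta j * C) := by
          gcongr
          exact hx _
      _ = _ := by ring

theorem l1_univ_le {C₂ : ℝ}
    (hC₂ : ∀ k l, M.l1 (M.comm Finset.univ k) ≤ C₂ * M.l1 (M.comm Finset.univ l)) (m : Fin K) :
    M.l1 Finset.univ ≤ K * C₂ * M.l1 (M.comm Finset.univ m) := by
  have : M.l1 Finset.univ = ∑ k, M.l1 (M.comm Finset.univ k) :=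
    (Finset.sum_fiberwise Finset.univ M.label fun j => |M.theta j|).symm
  rw [this]
  simpa [mul_assoc] using Finset.sum_le_card_nsmul Finset.univ _ _ fun k _ => hC₂ k m

theorem le_norm_profile_of_labeled (hM : M.IsDCBM) (x : Fin K → ℝ) (m : Fin K) :
    M.l1 (M.comm L m) * |x m| ≤ ‖profile M L S p x‖ := by
  refine le_trans (le_of_eq ?_) (abs_apply_le_euclidean_norm _ (Sum.inl m))
  have : profile M L S p x (Sum.inl m) = M.l1 (M.comm L m) * x m := by
    rw [profile_apply, Params.l1_eq hM, Finset.sum_mul]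
    simp only [coordWeight, Sum.elim_inl, ite_mul, one_mul, zero_mul, Finset.sum_ite_mem,
      Finset.univ_inter]
    refine Finset.sum_congr rfl fun j hj => ?_
    rw [(Finset.mem_filter.1 hj).2]
  rw [this, abs_mul, abs_of_nonneg (M.l1_nonneg _)]

/-- The estimated cluster `T⁻¹ m` should collect community `m` of `S`. Only misclassified nodes
contribute to the discrepancy, and their degree weight is at most `b₀ ‖θ‖₁`. -/
theorem le_norm_profile_of_unlabeled (hM : M.IsDCBM) {b₀ : ℝ} (hp : M.IsCorrect S b₀ p)
    (x : Fin K → ℝ) (m : Fin K) :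
    M.l1 (M.comm S m) * |x m| - b₀ * M.l1 Finset.univ * ‖x‖ ≤ ‖profile M L S p x‖ := by
  obtain ⟨T, hT⟩ := hp
  refine le_trans ?_ (abs_apply_le_euclidean_norm _ (Sum.inr (T.symm m)))
  have h1 : profile M L S p x (Sum.inr (T.symm m))
      = ∑ j : {j // j ∈ S}, (if T (p j) = m then 1 else 0) * (M.theta j * x (M.label j)) := by
    rw [profile_apply]
    simp only [coordWeight, Sum.elim_inr]
    rw [← sum_subtype_mul_eq (fun j => if p j = T.symm m then (1 : ℝ) else 0)]
    simp only [Equiv.eq_symm_apply]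
  have h2 : M.l1 (M.comm S m) * x m
      = ∑ j : {j // j ∈ S}, (if M.label j = m then 1 else 0) * (M.theta j * x (M.label j)) := by
    rw [Params.l1_eq hM, Finset.sum_mul, Params.comm, Finset.sum_filter, ← Finset.sum_coe_sort S]
    refine Finset.sum_congr rfl fun j _ => ?_
    split_ifs with h
    · rw [h, one_mul]
    · rw [zero_mul]
  have h3 : |M.l1 (M.comm S m) * x m - profile M L S p x (Sum.inr (T.symm m))|
      ≤ b₀ * M.l1 Finset.univ * ‖x‖ := by
    rw [h1, h2, ← Finset.sum_sub_distrib]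
    refine (Finset.abs_sum_le_sum_abs _ _).trans ?_
    refine le_trans ?_ (mul_le_mul_of_nonneg_right hT (norm_nonneg x))
    rw [Finset.sum_mul]
    refine Finset.sum_le_sum fun j _ => ?_
    have hj := hM.theta_pos j
    have hx : |x (M.label j)| ≤ ‖x‖ := norm_le_pi_norm x _
    rw [← sub_mul, abs_mul, abs_mul, abs_of_pos hj]
    by_cases h : T (p j) = M.label j
    · simp [h]
    · rw [if_pos h]
      have : |(if M.label j = m then (1 : ℝ) else 0) - (if T (p j) = m then 1 else 0)| ≤ 1 := by
        split_ifs <;> norm_num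
      calc _ ≤ 1 * (M.theta j * ‖x‖) := by gcongr
        _ = _ := one_mul _
  have h4 : M.l1 (M.comm S m) * |x m| = |M.l1 (M.comm S m) * x m| := by
    rw [abs_mul, abs_of_nonneg (M.l1_nonneg _)]
  rw [h4]
  have := abs_sub_abs_le_abs_sub (M.l1 (M.comm S m) * x m)
    (profile M L S p x (Sum.inr (T.symm m)))
  linarith

/-- The projection does not shrink profiles, as long as the clustering is roughly correct. -/
theorem le_norm_profile (hM : M.IsDCBM) {i : Fin n} {b₀ c C₂ : ℝ} (hK : 0 < K) (hC₂ : 0 < C₂)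
    (hc : c = 1 / (8 * K * C₂)) (hb : b₀ ≤ c) {p : {j // j ∈ Lᶜ.erase i} → Fin K}
    (hp : M.IsCorrect (Lᶜ.erase i) b₀ p)
    (hbal : ∀ k l, M.l1 (M.comm Finset.univ k) ≤ C₂ * M.l1 (M.comm Finset.univ l))
    (hi : M.theta i ≤ 4 * c * M.l1 Finset.univ) (x : Fin K → ℝ) :
    c * M.l1 Finset.univ * ‖x‖ ≤ ‖profile M L (Lᶜ.erase i) p x‖ := by
  have : Nonempty (Fin K) := ⟨⟨0, hK⟩⟩
  obtain ⟨m, hm⟩ : ∃ m, |x m| = ‖x‖ := by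
    obtain ⟨m, -, hm⟩ := Finset.exists_max_image Finset.univ (fun m => |x m|) Finset.univ_nonempty
    exact ⟨m, le_antisymm (norm_le_pi_norm x m)
      ((pi_norm_le_iff_of_nonneg (abs_nonneg _)).2 fun k => hm k (Finset.mem_univ k))⟩
  set R := M.l1 Finset.univ with hR
  have hR0 : 0 ≤ R := M.l1_nonneg _
  have hK' : (0 : ℝ) < K := by exact_mod_cast hK
  -- By balance, community `m` has mass at least `8cR`, of which node `i` removes at most `4cR`. So
  -- its labeled or its unlabeled part keeps `2cR`; in the unlabeled case, clustering errors cost at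
  -- most another `cR`.
  have hsplit : 4 * c * R ≤ M.l1 (M.comm L m) + M.l1 (M.comm (Lᶜ.erase i) m) := by
    have h1 : 8 * c * R ≤ M.l1 (M.comm Finset.univ m) := by
      have := l1_univ_le hbal m
      rw [hc]
      calc 8 * (1 / (8 * K * C₂)) * R = R / (K * C₂) := by field_simp
        _ ≤ _ := by
            rw [div_le_iff₀ (by positivity)]
            linarith
    have h2 : M.l1 (M.comm Finset.univ m)
        ≤ M.l1 (M.comm L m) + M.l1 (M.comm (Lᶜ.erase i) m) + M.theta i := by
      simp only [Params.l1_eq hM]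
      rw [← Finset.sum_singleton M.theta i]
      have hsub : M.comm Finset.univ m ⊆ M.comm L m ∪ M.comm (Lᶜ.erase i) m ∪ {i} := by
        intro j hj
        have hj' := (Finset.mem_filter.1 hj).2
        simp only [Params.comm, Finset.mem_union, Finset.mem_filter, Finset.mem_erase,
          Finset.mem_compl, Finset.mem_singleton, hj', and_true]
        tauto
      have hnn : ∀ j, 0 ≤ M.theta j := fun j => (hM.theta_pos j).le
      have hun : ∀ s t : Finset (Fin n),
          ∑ j ∈ s ∪ t, M.theta j ≤ ∑ j ∈ s, M.theta j + ∑ j ∈ t, M.theta j := fun s t => by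
        rw [← Finset.sum_union_inter]
        linarith [Finset.sum_nonneg fun j (_ : j ∈ s ∩ t) => hnn j]
      have h3 := Finset.sum_le_sum_of_subset_of_nonneg hsub fun j _ _ => hnn j
      linarith [hun (M.comm L m ∪ M.comm (Lᶜ.erase i) m) {i},
        hun (M.comm L m) (M.comm (Lᶜ.erase i) m)]
    linarith
  have hx := norm_nonneg x
  have h1 := le_norm_profile_of_labeled (L := L) (p := p) hM x m
  have h2 := le_norm_profile_of_unlabeled (L := L) hM hp x m
  rw [hm] at h1 h2
  have hbR : b₀ * R * ‖x‖ ≤ c * R * ‖x‖ := by gcongr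
  have hcR : 0 ≤ c * R := by
    have : 0 < c := by rw [hc]; positivity
    positivity
  by_cases hd : 2 * c * R ≤ M.l1 (M.comm L m)
  · have : 2 * c * R * ‖x‖ ≤ M.l1 (M.comm L m) * ‖x‖ := by gcongr
    nlinarith
  · have : 2 * c * R * ‖x‖ ≤ M.l1 (M.comm (Lᶜ.erase i) m) * ‖x‖ := by
      gcongr
      linarith
    linarith

end Features

/-! ### Concentration of the projected vectors and the error of AngleMin+. -/

section UpperBound

variable {n K : ℕ}

theorem labels_congr {U : Finset (Fin n)} (D : Detection n K U) (i : Fin n) {ω ω' : Config n}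
    (h : ∀ e : Pair n, e.1.1 ∈ U.erase i ∧ e.1.2 ∈ U.erase i → ω e = ω' e) :
    D.labels i ω = D.labels i ω' := by
  unfold Detection.labels
  congr 1
  ext u v
  exact adjacency_congr h u.2 v.2

theorem correctEvent_congr {U : Finset (Fin n)} (M : Params n K) (D : Detection n K U) (b₀ : ℝ)
    (i : Fin n) {ω ω' : Config n}
    (h : ∀ e : Pair n, e.1.1 ∈ U.erase i ∧ e.1.2 ∈ U.erase i → ω e = ω' e)
    (hω : ω ∈ correctEvent M D b₀ i) : ω' ∈ correctEvent M D b₀ i := by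
  unfold correctEvent at *
  rw [Set.mem_ofPred_eq] at *
  rwa [← labels_congr D i h]

/-- Deviation of `∑_{u ∈ A} ∑_v g_v A_{uv}` from its mean, for weights `g` that depend only on the
sub-network on a set `S` disjoint from `A`. -/
theorem bernProb_inter_bilinear_deviation_le {M : Params n K} (hP : M.P.IsSymm)
    (h0 : ∀ u v, 0 ≤ M.Omega u v) (h1 : ∀ e, edgeProb M e ≤ 1) {A S : Finset (Fin n)}
    (hAS : ∀ u ∈ A, u ∉ S) (B : Set (Config n)) (g : Config n → Fin n → ℝ)
    (hB : ∀ ω ω' : Config n, (∀ e : Pair n, e.1.1 ∈ S ∧ e.1.2 ∈ S → ω e = ω' e) → ω ∈ B → ω' ∈ B)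
    (hg : ∀ ω ω' : Config n, (∀ e : Pair n, e.1.1 ∈ S ∧ e.1.2 ∈ S → ω e = ω' e) → g ω = g ω')
    (hg0 : ∀ ω v, 0 ≤ g ω v) (hg1 : ∀ ω v, g ω v ≤ 1) {μ τ d : ℝ}
    (hμ : ∀ ω, ∑ v, g ω v * ∑ u ∈ A, M.Omega u v ≤ μ)
    (hd : ∀ ω, ∑ u ∈ A, g ω u * M.Omega u u ≤ d) (hτ0 : 0 ≤ τ) (hτ2 : τ ≤ 2) :
    bernProb (edgeProb M) (B ∩ {ω | τ * μ + d < |∑ v, g ω v * ∑ u ∈ A, adjacency ω u v -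
        ∑ v, g ω v * ∑ u ∈ A, M.Omega u v|})
      ≤ bernProb (edgeProb M) B * (2 * Real.exp (-(τ ^ 2 * μ / 8))) := by
  have he0 : ∀ e, 0 ≤ edgeProb M e := fun e => h0 _ _
  set a : Fin n → ℝ := fun u => if u ∈ A then 1 else 0 with ha
  have ha0 : ∀ u, 0 ≤ a u := fun u => by simp only [ha]; split_ifs <;> norm_num
  have ha1 : ∀ u, a u ≤ 1 := fun u => by simp only [ha]; split_ifs <;> norm_num
  have haS : ∀ u ∈ S, a u = 0 := fun u hu => if_neg fun h => hAS u h hu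
  have hbil : ∀ ω (X : Fin n → Fin n → ℝ),
      ∑ v, g ω v * ∑ u ∈ A, X u v = ∑ u, ∑ v, a u * (g ω v * X u v) := fun ω X => by
    rw [Finset.sum_comm]
    refine Finset.sum_congr rfl fun v _ => ?_
    simp only [ha, ite_mul, one_mul, zero_mul, Finset.sum_ite_mem, Finset.univ_inter,
      Finset.mul_sum]
  have hdiag : ∀ ω, ∑ u ∈ A, g ω u * M.Omega u u = ∑ u, a u * (g ω u * M.Omega u u) := fun ω => by
    simp only [ha, ite_mul, one_mul, zero_mul, Finset.sum_ite_mem, Finset.univ_inter]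
  -- Edges inside `S` get weight zero as `A` and `S` are disjoint, which permits conditioning on the
  -- sub-network on `S`. Edges inside `A` may be counted from both ends, hence the bound `2` on
  -- weights.
  set w : Config n → Pair n → ℝ := fun ω e => a e.1.1 * g ω e.1.2 + a e.1.2 * g ω e.1.1 with hw
  have hdiag0 : ∀ ω, 0 ≤ ∑ u, a u * (g ω u * M.Omega u u) := fun ω =>
    Finset.sum_nonneg fun u _ => mul_nonneg (ha0 u) (mul_nonneg (hg0 ω u) (h0 u u))
  have hpair : ∀ ω (X : Fin n → Fin n → ℝ), (∀ u v, X u v = X v u) →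
      ∑ v, g ω v * ∑ u ∈ A, X u v
        = ∑ e : Pair n, w ω e * X e.1.1 e.1.2 + ∑ u, a u * (g ω u * X u u) := fun ω X hX => by
    rw [hbil, sum_pair]
    congr 1
    refine Finset.sum_congr rfl fun e _ => ?_
    rw [hX e.1.2 e.1.1, hw]
    ring
  have hsymm := Params.Omega_symm hP
  have main := bernProb_inter_deviation_le he0 h1 (fun e => e.1.1 ∈ S ∧ e.1.2 ∈ S) B w hB
    (fun ω ω' h => by simp only [hw, hg ω ω' h])
    (fun ω e he => by simp only [hw, haS _ he.1, haS _ he.2, zero_mul, add_zero])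
    (fun ω e => add_nonneg (mul_nonneg (ha0 _) (hg0 _ _)) (mul_nonneg (ha0 _) (hg0 _ _)))
    (fun ω e => by
      have := mul_le_one₀ (ha1 e.1.1) (hg0 ω e.1.2) (hg1 ω e.1.2)
      have := mul_le_one₀ (ha1 e.1.2) (hg0 ω e.1.1) (hg1 ω e.1.1)
      simp only [hw]
      linarith) (μ := μ) (τ := τ) (fun ω => by
      have := hpair ω M.Omega hsymm
      have h3 := hμ ω
      have h4 := hdiag0 ω
      simp only [edgeProb]
      linarith) hτ0 hτ2
  refine (bernProb_mono he0 h1 ?_).trans main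
  rintro ω ⟨hωB, hω⟩
  refine ⟨hωB, ?_⟩
  rw [Set.mem_ofPred_eq] at *
  -- The diagonal of `A` is zero but that of `Ω` is not; the difference is the bias bounded by `d`.
  have e1 : ∑ u, a u * (g ω u * adjacency ω u u) = 0 :=
    Finset.sum_eq_zero fun u _ => by rw [adjacency_self]; ring
  rw [hpair ω _ (adjacency_symm ω), hpair ω _ hsymm, e1] at hω
  have e2 : ∑ e, w ω e * ((if ω e = true then 1 else 0) - edgeProb M e)
      = ∑ e : Pair n, w ω e * adjacency ω e.1.1 e.1.2 - ∑ e : Pair n, w ω e * M.Omega e.1.1 e.1.2 := by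
    rw [← Finset.sum_sub_distrib]
    refine Finset.sum_congr rfl fun e _ => ?_
    rw [adjacency_pair, edgeProb]
    ring
  have h3 := hd ω
  rw [hdiag] at h3
  have h4 := hdiag0 ω
  rw [e2]
  set x := ∑ e : Pair n, w ω e * adjacency ω e.1.1 e.1.2
  set z := ∑ e : Pair n, w ω e * M.Omega e.1.1 e.1.2
  set q := ∑ u, a u * (g ω u * M.Omega u u)
  have : |x + 0 - (z + q)| ≤ |x - z| + |q| := by
    rw [show x + 0 - (z + q) = (x - z) - q by ring]
    exact abs_sub _ _
  rw [abs_of_nonneg h4] at this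
  linarith

/-- The sets of nodes whose summed connections are compared: a node `i`, and the labeled
communities. -/
def anchor (M : Params n K) (L : Finset (Fin n)) (i : Fin n) : Option (Fin K) → Finset (Fin n)
  | none => {i}
  | some l => M.comm L l

/-- The projected connections of an anchor. -/
def anchorFeature (M : Params n K) (L : Finset (Fin n)) (D : Detection n K Lᶜ) (i : Fin n)
    (ω : Config n) (o : Option (Fin K)) : EuclideanSpace ℝ (Fin K ⊕ Fin K) :=
  feature M L (Lᶜ.erase i) (membership (D.labels i ω))
    fun v => ∑ u ∈ anchor M L i o, adjacency ω u v

variable {M : Params n K} {L : Finset (Fin n)} {D : Detection n K Lᶜ} {i : Fin n}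

/-- Puts both arguments of the angle in one form, so that a single deviation bound serves node `i`
and the labeled communities. -/
theorem psiHat_eq (ω : Config n) (l : Fin K) :
    psiHat M L D ω i l = InnerProductGeometry.angle (anchorFeature M L D i ω (some l))
      (anchorFeature M L D i ω none) := by
  unfold psiHat anchorFeature
  congr 2
  ext v
  simp [anchor, adjacency_symm ω v i]

theorem notMem_of_mem_anchor {o : Option (Fin K)} {u : Fin n} (hu : u ∈ anchor M L i o) :
    u ∉ Lᶜ.erase i := by
  cases o with
  | none => simp_all [anchor]
  | some l =>
    have : u ∈ L := (Finset.mem_filter.1 hu).1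
    simp [this]

/-- The deviation of a coordinate of an anchor from its mean. -/
theorem bernProb_inter_anchor_deviation_le (hM : M.IsDCBM) {C₁ ε δ : ℝ}
    (hC : ∀ k l, |M.P k l| ≤ C₁) (hiU : i ∈ Lᶜ) (hi : 2 * C₁ * M.theta i ≤ 1) (hC₁ : 0 < C₁)
    (hε0 : 0 ≤ ε) (hε1 : ε ≤ 1) (hδ0 : 0 ≤ δ) (hδ : δ ≤ C₁)
    (hbias : ∀ l, M.l2sq (M.comm L l) ≤ ε * δ * M.l1 Finset.univ * M.l1 (M.comm L l) / 2)
    (b₀ : ℝ) (k : Fin K) (o : Option (Fin K)) (s : Fin K ⊕ Fin K) :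
    bernProb (edgeProb (M.relabel i k)) (correctEvent M D b₀ i ∩
        {ω | ε * δ * M.l1 Finset.univ * M.l1 (anchor M L i o) <
          |anchorFeature M L D i ω o s - M.l1 (anchor M L i o) *
            profile M L (Lᶜ.erase i) (D.labels i ω) (M.P (o.getD k)) s|}) ≤
      bernProb (edgeProb (M.relabel i k)) (correctEvent M D b₀ i) *
        (2 * Real.exp (-(ε ^ 2 * δ ^ 2 * M.l1 (anchor M L i o) * M.l1 Finset.univ / (32 * C₁)))) := by
  set R := M.l1 Finset.univ with hR
  set σ := M.l1 (anchor M L i o) with hσ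
  have hR0 : 0 ≤ R := M.l1_nonneg _
  have hσ0 : 0 ≤ σ := M.l1_nonneg _
  have hiL : i ∉ L := Finset.mem_compl.1 hiU
  set g : Config n → Fin n → ℝ := fun ω => coordWeight M L (Lᶜ.erase i) (D.labels i ω) s with hg
  have hgi : ∀ ω, g ω i = 0 := fun ω => coordWeight_eq_zero hiL (by simp) s
  have hΩ : ∀ u ∈ anchor M L i o, ∀ v ≠ i, (M.relabel i k).Omega u v
      = M.theta u * (M.theta v * M.P (o.getD k) (M.label v)) := by
    intro u hu v hv
    cases o with
    | none =>
      obtain rfl : u = i := by simpa [anchor] using hu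
      rw [Params.relabel_Omega_left _ k hv, mul_assoc]
      rfl
    | some l =>
      have huL := Finset.mem_filter.1 hu
      rw [Params.relabel_Omega_of_ne i k (fun h => hiL (h ▸ huL.1)) hv, Params.Omega, huL.2,
        mul_assoc]
      rfl
  have hmean : ∀ ω, ∑ v, g ω v * ∑ u ∈ anchor M L i o, (M.relabel i k).Omega u v
      = σ * profile M L (Lᶜ.erase i) (D.labels i ω) (M.P (o.getD k)) s := by
    intro ω
    rw [profile_apply, hσ, Params.l1_eq hM, Finset.mul_sum]
    refine Finset.sum_congr rfl fun v _ => ?_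
    by_cases hv : v = i
    · have h1 := hgi ω
      have h2 := h1
      simp only [hg] at h2
      rw [hv, h1, h2]
      ring
    · rw [Finset.sum_congr rfl fun u hu => hΩ u hu v hv, ← Finset.sum_mul]
      ring
  have hdiag : ∀ ω, ∑ u ∈ anchor M L i o, g ω u * (M.relabel i k).Omega u u
      ≤ ε * δ * R * σ / 2 := by
    intro ω
    simp only [Params.relabel_Omega_self hM]
    cases o with
    | none =>
      simp only [anchor, Finset.sum_singleton, hgi, zero_mul]
      positivity
    | some l =>
      refine le_trans ?_ (hbias l)
      refine Finset.sum_le_sum fun u _ => ?_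
      nlinarith [coordWeight_le_one (M := M) (L := L) (p := D.labels i ω) s u, sq_nonneg (M.theta u)]
  -- The tolerance `εδRσ` is shared equally: `τ μ` is the half for random fluctuation and `d` the
  -- half for the diagonal bias.
  have hdev := bernProb_inter_bilinear_deviation_le (M := M.relabel i k) hM.P_symm
    (Params.relabel_Omega_nonneg hM i k) (Params.edgeProb_relabel_le_one hM hC hi k)
    (A := anchor M L i o) (S := Lᶜ.erase i)
    (fun u hu => notMem_of_mem_anchor hu) (correctEvent M D b₀ i) g
    (fun ω ω' h => correctEvent_congr M D b₀ i h)
    (fun ω ω' h => by simp only [hg, labels_congr D i h])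
    (fun ω v => coordWeight_nonneg s v) (fun ω v => coordWeight_le_one s v)
    (μ := σ * (C₁ * R)) (τ := ε * δ / (2 * C₁)) (d := ε * δ * R * σ / 2)
    (fun ω => by
      rw [hmean]
      refine mul_le_mul_of_nonneg_left ?_ hσ0
      exact (profile_apply_le hM (hM.P_nonneg _)
        (fun m => (le_abs_self _).trans (hC _ m)) s).2) hdiag (by positivity)
    (by
      rw [div_le_iff₀ (by positivity)]
      nlinarith)
  have e1 : ε * δ / (2 * C₁) * (σ * (C₁ * R)) + ε * δ * R * σ / 2 = ε * δ * R * σ := by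
    field_simp
    ring
  have e2 : (ε * δ / (2 * C₁)) ^ 2 * (σ * (C₁ * R)) / 8 = ε ^ 2 * δ ^ 2 * σ * R / (32 * C₁) := by
    field_simp
    ring
  simp only [hmean, e1, e2] at hdev
  simp only [anchorFeature, feature_apply]
  exact hdev

open InnerProductGeometry in
/-- When all anchors are close to their means, the angle with the true community is smallest. -/
theorem angle_anchorFeature_lt (hM : M.IsDCBM) {C₁ ε δ c : ℝ} (hC : ∀ k l, |M.P k l| ≤ C₁)
    (hC₁ : 0 < C₁) (hc : 0 < c) (hδ0 : 0 < δ) (hδ : δ ≤ C₁)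
    (hε1 : 8 * K * ε * C₁ ≤ c)
    (hε2 : 2 * K * ε * (3 + 2 * (2 * K * C₁ + c) / c) < c / (1 + 2 * C₁))
    (hsep : ∀ k l, k ≠ l → δ ≤ ‖M.P k - M.P l‖) (hL : ∀ l, 0 < M.l1 (M.comm L l))
    {ω : Config n} (hε0 : 0 ≤ ε)
    (hprof : ∀ x, c * M.l1 Finset.univ * ‖x‖ ≤ ‖profile M L (Lᶜ.erase i) (D.labels i ω) x‖)
    {k l : Fin K} (hkl : k ≠ l)
    (hdev : ∀ o s, |anchorFeature M L D i ω o s - M.l1 (anchor M L i o) *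
            profile M L (Lᶜ.erase i) (D.labels i ω) (M.P (o.getD k)) s|
        ≤ ε * δ * M.l1 Finset.univ * M.l1 (anchor M L i o)) :
    psiHat M L D ω i k < psiHat M L D ω i l := by
  set R := M.l1 Finset.univ with hRdef
  have hR : 0 < R := (hM.theta_pos i).trans_le (Params.theta_le_l1 hM (Finset.mem_univ i))
  set b : Fin K → EuclideanSpace ℝ (Fin K ⊕ Fin K) := fun m =>
    profile M L (Lᶜ.erase i) (D.labels i ω) (M.P m) with hb
  have hσ : ∀ o, 0 < M.l1 (anchor M L i o) := by
    rintro (_ | m)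
    · exact (hM.theta_pos i).trans_le (Params.theta_le_l1 hM (by simp [anchor]))
    · exact hL m
  -- Positive scaling leaves angles unchanged, so each anchor is divided by its degree mass and
  -- compared with a projected row of `P`.
  have hclose : ∀ o, ‖(M.l1 (anchor M L i o))⁻¹ • anchorFeature M L D i ω o - b (o.getD k)‖
      ≤ 2 * K * (ε * δ * R) := by
    intro o
    have hσo := hσ o
    have := euclidean_norm_le_card_mul (ρ := ε * δ * R)
      ((M.l1 (anchor M L i o))⁻¹ • anchorFeature M L D i ω o - b (o.getD k)) fun s => by
        have h := hdev o s
        have e : ((M.l1 (anchor M L i o))⁻¹ • anchorFeature M L D i ω o - b (o.getD k)) s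
            = (M.l1 (anchor M L i o))⁻¹ * (anchorFeature M L D i ω o s -
              M.l1 (anchor M L i o) * b (o.getD k) s) := by
          simp only [PiLp.sub_apply, PiLp.smul_apply, smul_eq_mul]
          field_simp
        rw [e, abs_mul, abs_of_pos (inv_pos.2 hσo), inv_mul_le_iff₀ hσo, mul_comm _ (ε * δ * R)]
        exact h
    refine this.trans (le_of_eq ?_)
    rw [Fintype.card_sum, Fintype.card_fin]
    push_cast
    ring
  have hnorm : ∀ m, c * R ≤ ‖b m‖ := by
    intro m
    refine le_trans ?_ (hprof (M.P m))
    have : 1 ≤ ‖M.P m‖ := by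
      have := norm_le_pi_norm (M.P m) m
      rwa [hM.P_diag, norm_one] at this
    nlinarith [mul_pos hc hR]
  have hBb : ‖b k‖ ≤ 2 * K * C₁ * R := by
    have := euclidean_norm_le_card_mul (ρ := C₁ * R) (b k) fun s => by
      have := profile_apply_le (L := L) (p := D.labels i ω) hM (hM.P_nonneg k)
        (fun m => (le_abs_self _).trans (hC k m)) s
      rw [abs_of_nonneg this.1]
      exact this.2
    refine this.trans (le_of_eq ?_)
    rw [Fintype.card_sum, Fintype.card_fin]
    push_cast
    ring
  have hΓ : ∀ t : ℝ, c * R * δ / (1 + 2 * C₁) ≤ ‖b k - t • b l‖ := by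
    intro t
    have h1 := hprof (M.P k - t • M.P l)
    rw [profile_sub_smul] at h1
    refine le_trans ?_ h1
    rw [div_le_iff₀ (by positivity)]
    have h2 := norm_sub_le_mul_norm_sub_smul hM.P_symm hM.P_diag hM.P_nonneg hC k l t
    have h3 := hsep k l hkl
    calc c * R * δ ≤ c * R * ((1 + 2 * C₁) * ‖M.P k - t • M.P l‖) := by
          gcongr
          linarith
      _ = _ := by ring
  rw [psiHat_eq, psiHat_eq]
  have := angle_lt_angle_of_close (N := c * R) (by positivity) (by
      calc 4 * (2 * K * (ε * δ * R)) = 8 * K * ε * δ * R := by ring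
        _ ≤ 8 * K * ε * C₁ * R := by gcongr
        _ ≤ _ := by gcongr) (hclose none) (hclose (some k)) (hclose (some l)) (hnorm k) (hnorm l)
    hBb hΓ (by
      have e1 : 2 * (2 * K * C₁ * R + c * R) / (c * R) = 2 * (2 * K * C₁ + c) / c := by
        field_simp
      rw [e1]
      calc _ = 2 * K * ε * (3 + 2 * (2 * K * C₁ + c) / c) * (δ * R) := by ring
        _ < c / (1 + 2 * C₁) * (δ * R) := by gcongr
        _ = _ := by ring)
  rwa [angle_smul_left_of_pos _ _ (inv_pos.2 (hσ _)), angle_smul_right_of_pos _ _ (inv_pos.2 (hσ _)),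
    angle_smul_left_of_pos _ _ (inv_pos.2 (hσ _)), angle_smul_right_of_pos _ _ (inv_pos.2 (hσ _))]
    at this

/-- The error of AngleMin+ at a node, on the event that the clustering is roughly correct. -/
theorem law_inter_error_le (hM : M.IsDCBM) {C₁ C₃ ε δ c b₀ : ℝ} (hC : ∀ k l, |M.P k l| ≤ C₁)
    (hiU : i ∈ Lᶜ) (hi : 2 * C₁ * M.theta i ≤ 1)
    (hC₁ : 0 < C₁) (hC₃ : 1 ≤ C₃) (hc : 0 < c) (hδ0 : 0 < δ) (hδ : δ ≤ C₁)
    (hε0 : 0 ≤ ε) (hε : ε ≤ 1) (hε1 : 8 * K * ε * C₁ ≤ c)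
    (hε2 : 2 * K * ε * (3 + 2 * (2 * K * C₁ + c) / c) < c / (1 + 2 * C₁))
    (hsep : ∀ k l, k ≠ l → δ ≤ ‖M.P k - M.P l‖)
    (hL : ∀ l, M.theta i ≤ C₃ * M.l1 (M.comm L l))
    (hbias : ∀ l, M.l2sq (M.comm L l) ≤ ε * δ * M.l1 Finset.univ * M.l1 (M.comm L l) / 2)
    (hprof : ∀ p, M.IsCorrect (Lᶜ.erase i) b₀ p →
      ∀ x, c * M.l1 Finset.univ * ‖x‖ ≤ ‖profile M L (Lᶜ.erase i) p x‖)
    {y : Classifier n K Lᶜ} (hy : IsAngleMinPlus M L D y) (k : Fin K) :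
    (M.relabel i k).law.real (correctEvent M D b₀ i ∩ {ω | y ω ⟨i, hiU⟩ ≠ k}) ≤
      (M.relabel i k).law.real (correctEvent M D b₀ i) * (4 * K * (K + 1) *
        Real.exp (-(ε ^ 2 / (32 * C₁ * C₃) * (δ ^ 2 * M.theta i * M.l1 Finset.univ)))) := by
  have p0 := Params.edgeProb_relabel_nonneg hM i k
  have p1 := Params.edgeProb_relabel_le_one hM hC hi k
  rw [law_real p0 p1, law_real p0 p1]
  set R := M.l1 Finset.univ with hRdef
  have hR : 0 ≤ R := M.l1_nonneg _
  set B := correctEvent M D b₀ i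
  have hθ := hM.theta_pos i
  have hC₃' : 0 < C₃ := by linarith
  have hLpos : ∀ l, 0 < M.l1 (M.comm L l) := fun l => by
    by_contra! h
    nlinarith [hL l]
  set F : Option (Fin K) × (Fin K ⊕ Fin K) → Set (Config n) := fun q =>
    {ω | ε * δ * R * M.l1 (anchor M L i q.1) <
          |anchorFeature M L D i ω q.1 q.2 - M.l1 (anchor M L i q.1) *
            profile M L (Lᶜ.erase i) (D.labels i ω) (M.P (q.1.getD k)) q.2|} with hF
  -- If no coordinate deviates, the angle at `k` is strictly smallest, so the tie-breaking rule is
  -- irrelevant.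
  have hsub : B ∩ {ω | y ω ⟨i, hiU⟩ ≠ k} ⊆ ⋃ q, B ∩ F q := by
    rintro ω ⟨hωB, hωy⟩
    by_contra hcon
    simp only [Set.mem_iUnion, Set.mem_inter_iff, hωB, true_and, not_exists, hF, Set.mem_ofPred_eq,
      not_lt] at hcon
    have hlt := angle_anchorFeature_lt hM hC hC₁ hc hδ0 hδ hε1 hε2 hsep hLpos hε0
      (hprof _ hωB) (Ne.symm hωy) fun o s => hcon (o, s)
    exact absurd (hy ω ⟨i, hiU⟩ k) (not_le.2 hlt)
  have hPB := bernProb_nonneg p0 p1 B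
  have hq : ∀ q, bernProb (edgeProb (M.relabel i k)) (B ∩ F q) ≤
      bernProb (edgeProb (M.relabel i k)) B *
        (2 * Real.exp (-(ε ^ 2 / (32 * C₁ * C₃) * (δ ^ 2 * M.theta i * R)))) := by
    rintro ⟨o, s⟩
    refine (bernProb_inter_anchor_deviation_le hM hC hiU hi hC₁ hε0 hε hδ0.le hδ hbias b₀ k o
      s).trans ?_
    -- Every anchor has mass comparable to `θ_i` or larger, so all deviations have exponent of order
    -- at least `δ² θ_i ‖θ‖₁`.
    have hσ : M.theta i / C₃ ≤ M.l1 (anchor M L i o) := by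
      rw [div_le_iff₀' hC₃']
      cases o with
      | none =>
        have : M.theta i ≤ M.l1 (anchor M L i none) := Params.theta_le_l1 hM (by simp [anchor])
        nlinarith
      | some l => exact hL l
    refine mul_le_mul_of_nonneg_left ?_ hPB
    refine mul_le_mul_of_nonneg_left (Real.exp_le_exp.2 (neg_le_neg ?_)) two_pos.le
    calc _ = ε ^ 2 * δ ^ 2 * (M.theta i / C₃) * R / (32 * C₁) := by field_simp
      _ ≤ _ := by gcongr
  calc _ ≤ _ := bernProb_mono p0 p1 hsub
    _ ≤ _ := bernProb_iUnion_le p0 p1 _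
    _ ≤ ∑ q : Option (Fin K) × (Fin K ⊕ Fin K), _ := Finset.sum_le_sum fun q _ => hq q
    _ = _ := by
        rw [Finset.sum_const, Finset.card_univ, Fintype.card_prod, Fintype.card_option,
          Fintype.card_sum, Fintype.card_fin, nsmul_eq_mul]
        push_cast
        ring

end UpperBound

/-! ### Null sets, conditional risk, and comparison of exponents. -/

section Rate

variable {n K : ℕ} {M : Params n K}

/-- Edges at `i` have probability in `(0, 1/2]` under every label of `i`, and other edges are
unaffected. Hence configurations of zero mass are the same for all labels. -/
theorem law_relabel_real_eq_zero (hM : M.IsDCBM) {C₁ : ℝ} (hC : ∀ k l, |M.P k l| ≤ C₁)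
    (hpos : ∀ k l, 0 < M.P k l) {i : Fin n} (hi : 2 * C₁ * M.theta i ≤ 1) (k l : Fin K)
    {S : Set (Config n)} (h : (M.relabel i k).law.real S = 0) : (M.relabel i l).law.real S = 0 := by
  have p0 := fun k => Params.edgeProb_relabel_nonneg hM i k
  have p1 := fun k => Params.edgeProb_relabel_le_one hM hC hi k
  rw [law_real (p0 k) (p1 k), bernProb, Finset.sum_eq_zero_iff_of_nonneg fun _ _ =>
    Set.indicator_nonneg (fun _ _ => bernMass_nonneg (p0 k) (p1 k) _) _] at h
  rw [law_real (p0 l) (p1 l)]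
  refine Finset.sum_eq_zero fun ω hω => ?_
  by_cases hωS : ω ∈ S
  · have h0 := h ω hω
    rw [Set.indicator_of_mem hωS] at h0 ⊢
    obtain ⟨e, -, he⟩ := Finset.prod_eq_zero_iff.1 h0
    refine Finset.prod_eq_zero (Finset.mem_univ e) ?_
    by_cases hinc : e.1.1 = i ∨ e.1.2 = i
    · obtain ⟨v, -, hv, -⟩ := Params.exists_edgeProb_relabel_eq hM.P_symm hinc
      have h1 := mul_pos (mul_pos (hM.theta_pos i) (hM.theta_pos v)) (hpos k (M.label v))
      have h2 := Params.theta_mul_le_half hM hC hi v k (M.label v)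
      rw [hv] at he
      split_ifs at he <;> linarith
    · push Not at hinc
      rwa [Params.edgeProb_relabel_of_ne i l k hinc.1 hinc.2]
  · exact Set.indicator_of_notMem hωS _

theorem cond_law_real (M : Params n K) (B S : Set (Config n)) :
    (ProbabilityTheory.cond M.law B).real S = (M.law.real B)⁻¹ * M.law.real (B ∩ S) := by
  rw [measureReal_def, cond_apply (Set.toFinite B).measurableSet, ENNReal.toReal_mul,
    ENNReal.toReal_inv]
  rfl

theorem cond_law_real_le_one (M : Params n K) (B S : Set (Config n)) :
    (ProbabilityTheory.cond M.law B).real S ≤ 1 := by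
  rw [cond_law_real]
  exact inv_mul_le_one_of_le₀ (measureReal_mono Set.inter_subset_left) measureReal_nonneg

theorem cond_law_real_eq_of_compl {B : Set (Config n)} (hB : M.law.real Bᶜ = 0)
    (S : Set (Config n)) : (ProbabilityTheory.cond M.law B).real S = M.law.real S := by
  have hle : ∀ T : Set (Config n), M.law.real T = M.law.real (B ∩ T) := by
    intro T
    refine le_antisymm ?_ (measureReal_mono Set.inter_subset_right)
    have h1 : M.law.real T ≤ M.law.real ((B ∩ T) ∪ Bᶜ) := measureReal_mono fun ω hω => by
      by_cases h : ω ∈ B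
      · exact Or.inl ⟨h, hω⟩
      · exact Or.inr h
    have h2 := measureReal_union_le (μ := M.law) (B ∩ T) Bᶜ
    linarith
  have h1 : M.law.real B = 1 := by
    rw [← Set.inter_univ B, ← hle, probReal_univ]
  rw [cond_law_real, ← hle, h1, inv_one, one_mul]

/-- Take logarithms in `h`. Positivity of `r` and `s` matters because `Real.log 0 = 0`. -/
theorem RateEfficient.of_mul_le_rpow {c r s : ℝ} (hc : 0 < c) (hr : 0 < r) (hs : 0 < s)
    (h : c * r ≤ s ^ c) : RateEfficient c r s := by
  have hlog : c * (-Real.log s) ≤ -Real.log (c * r) := by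
    have := Real.log_le_log (mul_pos hc hr) h
    rw [Real.log_rpow hs] at this
    linarith
  refine ⟨fun hs1 => ?_, hlog⟩
  rwa [le_div_iff₀ (neg_pos.2 (Real.log_neg hs hs1))]

/-- Averages of exponentials are comparable on the scale of exponents. -/
theorem mul_le_rpow_of_exp_averages {ι : Type*} (U : Finset ι) (hU : U.Nonempty)
    {x : ι → ℝ} (hx : ∀ i ∈ U, 0 ≤ x i) {a κ A c r s : ℝ} (hc0 : 0 < c) (hc1 : c ≤ 1)
    (hcκ : c * a ≤ κ) (hcA : c * (2 * A) ≤ 1)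
    (hs : (∑ i ∈ U, Real.exp (-(a * x i)) / 2) / U.card ≤ s)
    (hr : r ≤ (∑ i ∈ U, A * Real.exp (-(κ * x i))) / U.card) : c * r ≤ s ^ c := by
  have hcard : (0 : ℝ) < U.card := by exact_mod_cast hU.card_pos
  have hJ := (Real.concaveOn_rpow hc0.le hc1).le_map_sum (t := U) (w := fun _ => (U.card : ℝ)⁻¹)
    (p := fun i => Real.exp (-(a * x i)) / 2) (fun _ _ => by positivity)
    (by rw [Finset.sum_const, nsmul_eq_mul, mul_inv_cancel₀ hcard.ne'])
    (fun i _ => by rw [Set.mem_Ici]; positivity)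
  simp only [smul_eq_mul, ← Finset.mul_sum] at hJ
  -- Here `c a ≤ κ` compares the exponents and `2 ^ c ≤ 2` the prefactors.
  have hterm : ∀ i ∈ U, Real.exp (-(κ * x i)) / 2 ≤ (Real.exp (-(a * x i)) / 2) ^ c := by
    intro i hi
    rw [Real.div_rpow (Real.exp_pos _).le two_pos.le, ← Real.exp_mul]
    have h1 : (2 : ℝ) ^ c ≤ 2 := by
      simpa using Real.rpow_le_rpow_of_exponent_le one_le_two hc1
    have h2 : -(κ * x i) ≤ -(a * x i) * c := by nlinarith [hx i hi]
    gcongr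
  have hE : 0 ≤ ∑ i ∈ U, Real.exp (-(κ * x i)) := Finset.sum_nonneg fun _ _ => (Real.exp_pos _).le
  calc c * r ≤ c * ((∑ i ∈ U, A * Real.exp (-(κ * x i))) / U.card) := by gcongr
    _ = c * (2 * A) * ((∑ i ∈ U, Real.exp (-(κ * x i))) / 2 / U.card) := by
        rw [← Finset.mul_sum]; ring
    _ ≤ 1 * ((∑ i ∈ U, Real.exp (-(κ * x i))) / 2 / U.card) := by gcongr
    _ = (U.card : ℝ)⁻¹ * ∑ i ∈ U, Real.exp (-(κ * x i)) / 2 := by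
        rw [← Finset.sum_div]; ring
    _ ≤ (U.card : ℝ)⁻¹ * ∑ i ∈ U, (Real.exp (-(a * x i)) / 2) ^ c := by
        gcongr with i hi
        exact hterm i hi
    _ ≤ _ := hJ
    _ ≤ s ^ c := by
        refine Real.rpow_le_rpow ?_ ?_ hc0.le
        · positivity
        · rwa [inv_mul_eq_div]

theorem le_riskIns (hM : M.IsDCBM) {U : Finset (Fin n)} {C₁ : ℝ} (hC : ∀ k l, |M.P k l| ≤ C₁)
    (hi : ∀ i ∈ U, 2 * C₁ * M.theta i ≤ 1) {r : ℝ} (hr0 : 0 < r) (hr : ∀ k l, r ≤ M.P k l)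
    {k l : Fin K} (hkl : k ≠ l) (y : Classifier n K U) :
    (∑ i ∈ U, Real.exp (-(2 / r * (‖M.P k - M.P l‖ ^ 2 * M.theta i * M.l1 Finset.univ))) / 2)
      / U.card ≤ riskIns M y := by
  unfold riskIns
  gcongr
  rw [← Finset.sum_coe_sort U]
  refine Finset.sum_le_sum fun i _ => ?_
  refine (Params.exp_le_law_add_law hM hC (hi i i.2) hr0 hr k l (S := {ω | y ω i ≠ k})
    (T := {ω | y ω i ≠ l}) ?_).trans ?_
  · ext ω
    simp only [Set.mem_union, Set.mem_ofPred_eq, Set.mem_univ, iff_true]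
    by_contra! h
    exact hkl (h.1.symm.trans h.2)
  · rw [← Finset.sum_pair (f := fun k => (M.relabel i k).law.real {ω | y ω i ≠ k}) hkl]
    exact Finset.sum_le_sum_of_subset_of_nonneg (Finset.subset_univ _)
      fun _ _ _ => measureReal_nonneg

theorem le_bestRiskIns {U : Finset (Fin n)} {b : ℝ} (hK : 0 < K)
    (h : ∀ y : Classifier n K U, b ≤ riskIns M y) : b ≤ bestRiskIns M U :=
  have : Nonempty (Classifier n K U) := ⟨fun _ _ => ⟨0, hK⟩⟩
  le_ciInf h

/-- If the risk vanished, `B i ∩ {y_i ≠ k}` and `B i ∩ {y_i ≠ l}` would be null under the original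
label too, although they cover `B i`. -/
theorem riskInsGiven_pos (hM : M.IsDCBM) {U : Finset (Fin n)} (hU : U.Nonempty) {C₁ : ℝ}
    (hC : ∀ k l, |M.P k l| ≤ C₁) (hpos : ∀ k l, 0 < M.P k l)
    (hi : ∀ i ∈ U, 2 * C₁ * M.theta i ≤ 1) {k l : Fin K} (hkl : k ≠ l) {B : Fin n → Set (Config n)}
    (hB : ∀ i ∈ U, M.law.real (B i) ≠ 0) (y : Classifier n K U) : 0 < riskInsGiven M B y := by
  obtain ⟨i, hiU⟩ := hU
  have hnn : ∀ (i : {i // i ∈ U}) (k : Fin K),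
      0 ≤ (ProbabilityTheory.cond (M.relabel i k).law (B i)).real {ω | y ω i ≠ k} :=
    fun _ _ => measureReal_nonneg
  refine div_pos ?_ (by exact_mod_cast Finset.card_pos.2 ⟨i, hiU⟩)
  refine lt_of_lt_of_le ?_ (Finset.single_le_sum
    (f := fun i : {i // i ∈ U} => ∑ k, (ProbabilityTheory.cond (M.relabel i k).law (B i)).real
      {ω | y ω i ≠ k}) (fun i _ => Finset.sum_nonneg fun k _ => hnn i k)
    (Finset.mem_univ (⟨i, hiU⟩ : {i // i ∈ U})))
  refine (Finset.sum_nonneg fun k _ => hnn ⟨i, hiU⟩ k).lt_of_ne' fun h0 => hB i hiU ?_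
  rw [Finset.sum_eq_zero_iff_of_nonneg fun k _ => hnn ⟨i, hiU⟩ k] at h0
  have hlaw : ∀ m, (M.relabel i (M.label i)).law.real (B i ∩ {ω | y ω ⟨i, hiU⟩ ≠ m}) = 0 := by
    intro m
    have h1 := h0 m (Finset.mem_univ m)
    rw [cond_law_real, mul_eq_zero, inv_eq_zero] at h1
    refine law_relabel_real_eq_zero hM hC hpos (hi i hiU) m _ ?_
    rcases h1 with h1 | h1
    · exact le_antisymm (h1 ▸ measureReal_mono Set.inter_subset_left) measureReal_nonneg
    · exact h1
  rw [Params.relabel_label] at hlaw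
  refine le_antisymm ?_ measureReal_nonneg
  calc _ ≤ M.law.real ((B i ∩ {ω | y ω ⟨i, hiU⟩ ≠ k}) ∪ (B i ∩ {ω | y ω ⟨i, hiU⟩ ≠ l})) := by
        refine measureReal_mono fun ω hω => ?_
        by_cases h : y ω ⟨i, hiU⟩ = k
        · exact Or.inr ⟨hω, fun h' => hkl (h.symm.trans h')⟩
        · exact Or.inl ⟨hω, h⟩
    _ ≤ _ := measureReal_union_le _ _
    _ = 0 := by rw [hlaw, hlaw, add_zero]

theorem riskInsGiven_eq_riskIns (hM : M.IsDCBM) {U : Finset (Fin n)} {C₁ : ℝ}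
    (hC : ∀ k l, |M.P k l| ≤ C₁) (hpos : ∀ k l, 0 < M.P k l)
    (hi : ∀ i ∈ U, 2 * C₁ * M.theta i ≤ 1) {B : Fin n → Set (Config n)}
    (hB : ∀ i ∈ U, M.law.real (B i)ᶜ = 0) (y : Classifier n K U) :
    riskInsGiven M B y = riskIns M y := by
  unfold riskInsGiven riskIns
  congr 1
  refine Finset.sum_congr rfl fun i _ => Finset.sum_congr rfl fun k _ => ?_
  refine cond_law_real_eq_of_compl (law_relabel_real_eq_zero hM hC hpos (hi i i.2) (M.label i) k ?_)
    _
  rw [Params.relabel_label]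
  exact hB i i.2

theorem exists_closest_rows (hK : 2 ≤ K) (P : Matrix (Fin K) (Fin K) ℝ) :
    ∃ k l, k ≠ l ∧ ∀ k' l', k' ≠ l' → ‖P k - P l‖ ≤ ‖P k' - P l'‖ := by
  obtain ⟨q, hq, hmin⟩ := Finset.exists_min_image
    (Finset.univ.filter fun q : Fin K × Fin K => q.1 ≠ q.2) (fun q => ‖P q.1 - P q.2‖)
    ⟨(⟨0, by lia⟩, ⟨1, by lia⟩), by simp⟩
  exact ⟨q.1, q.2, (Finset.mem_filter.1 hq).2, fun k' l' h => hmin (k', l') (by simpa using h)⟩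

/-- Entries lie in `[0, C₁]`, so no factor `2` is lost. The resulting `δ ≤ C₁` keeps the Chernoff
parameter in range. -/
theorem norm_row_sub_le (hM : M.IsDCBM) {C₁ : ℝ} (hC : ∀ k l, |M.P k l| ≤ C₁) (k l : Fin K) :
    ‖M.P k - M.P l‖ ≤ C₁ := by
  refine (pi_norm_le_iff_of_nonneg ((abs_nonneg _).trans (hC k k))).2 fun m => ?_
  exact abs_sub_le_of_nonneg_of_le (hM.P_nonneg k m) ((le_abs_self _).trans (hC k m))
    (hM.P_nonneg l m) ((le_abs_self _).trans (hC l m))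

/-- Both constraints are linear in `ε`; the `2Q` in the witness secures the strict inequality. -/
theorem exists_noise_level {K C₁ c : ℝ} (hK : 0 < K) (hC₁ : 0 < C₁) (hc : 0 < c) :
    ∃ ε : ℝ, 0 < ε ∧ ε ≤ 1 ∧ 8 * K * ε * C₁ ≤ c ∧
      2 * K * ε * (3 + 2 * (2 * K * C₁ + c) / c) < c / (1 + 2 * C₁) := by
  set Q := 2 * K * (3 + 2 * (2 * K * C₁ + c) / c) with hQ
  set G := c / (1 + 2 * C₁) with hG
  have hQ0 : 0 < Q := by positivity
  have hG0 : 0 < G := by positivity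
  refine ⟨min 1 (min (c / (8 * K * C₁)) (G / (2 * Q))), by positivity, min_le_left _ _, ?_, ?_⟩
  · have h := (min_le_right 1 _).trans (min_le_left (c / (8 * K * C₁)) (G / (2 * Q)))
    rw [le_div_iff₀ (by positivity)] at h
    linarith
  · have h := (min_le_right 1 _).trans (min_le_right (c / (8 * K * C₁)) (G / (2 * Q)))
    rw [le_div_iff₀ (by positivity)] at h
    set ε := min 1 (min (c / (8 * K * C₁)) (G / (2 * Q)))
    have : 2 * K * ε * (3 + 2 * (2 * K * C₁ + c) / c) = ε * Q := by rw [hQ]; ring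
    rw [this]
    linarith

/-- The conditional error of AngleMin+ at a node, summed over the labels of that node. -/
theorem sum_cond_error_le (hM : M.IsDCBM) {L : Finset (Fin n)} {D : Detection n K Lᶜ}
    {C₁ C₂ C₃ ε δ c b₀ : ℝ} (hK : 0 < K) (hC : ∀ k l, |M.P k l| ≤ C₁)
    {i : Fin n} (hiU : i ∈ Lᶜ) (hi : 2 * C₁ * M.theta i ≤ 1)
    (hC₁ : 0 < C₁) (hC₂ : 0 < C₂) (hC₃ : 1 ≤ C₃) (hc : c = 1 / (8 * K * C₂)) (hδ0 : 0 < δ)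
    (hδ : δ ≤ C₁) (hε0 : 0 ≤ ε) (hε : ε ≤ 1) (hε1 : 8 * K * ε * C₁ ≤ c)
    (hε2 : 2 * K * ε * (3 + 2 * (2 * K * C₁ + c) / c) < c / (1 + 2 * C₁))
    (hsep : ∀ k l, k ≠ l → δ ≤ ‖M.P k - M.P l‖)
    (hL : ∀ l, M.theta i ≤ C₃ * M.l1 (M.comm L l))
    (hbias : ∀ l, M.l2sq (M.comm L l) ≤ ε * δ * M.l1 Finset.univ * M.l1 (M.comm L l) / 2)
    (hb : b₀ ≤ c)
    (hbal : ∀ k l, M.l1 (M.comm Finset.univ k) ≤ C₂ * M.l1 (M.comm Finset.univ l))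
    (hB : ∀ k, (M.relabel i k).law.real (correctEvent M D b₀ i) ≠ 0)
    {y : Classifier n K Lᶜ} (hy : IsAngleMinPlus M L D y) {κ : ℝ}
    (hκ : κ = ε ^ 2 / (32 * C₁ * C₃)) :
    ∑ k, (ProbabilityTheory.cond (M.relabel i k).law (correctEvent M D b₀ i)).real
        {ω | y ω ⟨i, hiU⟩ ≠ k} ≤
      K * (4 * K * (K + 1)) * Real.exp (κ * (C₁ ^ 2 / (4 * c))) *
        Real.exp (-(κ * (δ ^ 2 * M.theta i * M.l1 Finset.univ))) := by
  have hK1 : (1 : ℝ) ≤ K := by exact_mod_cast hK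
  have hc0 : 0 < c := by rw [hc]; positivity
  have hκ0 : 0 ≤ κ := by rw [hκ]; positivity
  set x := δ ^ 2 * M.theta i * M.l1 Finset.univ with hx
  have hterm : ∀ k, (ProbabilityTheory.cond (M.relabel i k).law (correctEvent M D b₀ i)).real
        {ω | y ω ⟨i, hiU⟩ ≠ k} ≤ 4 * K * (K + 1) * Real.exp (κ * (C₁ ^ 2 / (4 * c))) *
        Real.exp (-(κ * x)) := by
    intro k
    -- If `θ_i` is a large share of `‖θ‖₁`, removing `i` could empty a community. But then `x ≤ C₁²
    -- / (4c)`, and the extra exponential factor makes the bound at least `1`.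
    by_cases hgood : M.theta i ≤ 4 * c * M.l1 Finset.univ
    · have h1 := law_inter_error_le hM hC hiU hi hC₁ hC₃ hc0 hδ0 hδ hε0 hε hε1 hε2 hsep hL hbias
        (fun p hp => le_norm_profile hM hK hC₂ hc hb hp hbal hgood) hy k
      rw [← hκ, ← hx] at h1
      rw [cond_law_real, inv_mul_le_iff₀ (measureReal_nonneg.lt_of_ne' (hB k))]
      refine h1.trans (mul_le_mul_of_nonneg_left ?_ measureReal_nonneg)
      have : 1 ≤ Real.exp (κ * (C₁ ^ 2 / (4 * c))) := Real.one_le_exp (by positivity)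
      refine mul_le_mul_of_nonneg_right ?_ (Real.exp_pos _).le
      exact le_mul_of_one_le_right (by positivity) this
    · push Not at hgood
      refine (cond_law_real_le_one _ _ _).trans ?_
      rw [mul_assoc, ← Real.exp_add]
      have hxle : x ≤ C₁ ^ 2 / (4 * c) := by
        have hθ0 := hM.theta_pos i
        have hθ1 := hM.theta_le_one i
        rw [le_div_iff₀ (by positivity)]
        calc x * (4 * c) = δ ^ 2 * M.theta i * (4 * c * M.l1 Finset.univ) := by rw [hx]; ring
          _ ≤ C₁ ^ 2 * 1 * 1 := by
              have := M.l1_nonneg Finset.univ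
              gcongr
              linarith
          _ = _ := by ring
      have h1 : 1 ≤ Real.exp (κ * (C₁ ^ 2 / (4 * c)) + -(κ * x)) :=
        Real.one_le_exp (by nlinarith)
      exact one_le_mul_of_one_le_of_one_le (by nlinarith) h1
  calc _ ≤ ∑ _k : Fin K, _ := Finset.sum_le_sum fun k _ => hterm k
    _ = _ := by
        rw [Finset.sum_const, Finset.card_univ, Fintype.card_fin, nsmul_eq_mul]
        ring

end Rate

end SemiSup

end

/-! ### Choice of constants and conclusion. -/

theorem theorem5 (K : ℕ) (hK : 2 ≤ K) (C₁ C₂ : ℝ) (hC₁ : 0 < C₁) (hC₂ : 0 < C₂) :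
    -- the thresholds in "`b₀` and `c₃` properly small, `C₃` sufficiently large"
    ∃ bbar > (0 : ℝ), ∃ cbar > (0 : ℝ), ∃ Cbar > (0 : ℝ),
      ∀ r₀ > (0 : ℝ), ∀ c₃ > (0 : ℝ), c₃ ≤ cbar → ∀ C₃ ≥ Cbar,
      -- the constant depends only on `K, C₁, C₂, C₃, c₃, r₀`
      ∃ c > (0 : ℝ),
        ∀ b₀ > (0 : ℝ), b₀ < 1 → b₀ ≤ bbar →
        ∀ (n : ℕ) (β : ℝ) (M : SemiSup.Params n K) (L : Finset (Fin n))
          (D : SemiSup.Detection n K Lᶜ) (y : SemiSup.Classifier n K Lᶜ),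
          0 < β → Lᶜ.Nonempty → M.IsDCBM → M.CondP C₁ β → M.CondTheta L C₂ c₃ β →
          (∀ i ∈ Lᶜ, M.theta i ≤ 1 / C₃) →
          (∀ i ∈ Lᶜ, ∀ k, M.theta i ≤ C₃ * M.l1 (M.comm L k)) →
          (∀ i ∈ Lᶜ, Real.log (Lᶜ.card : ℝ) ≤ C₃ * β ^ 2 * M.l1 Finset.univ * M.theta i) →
          (∀ k l, k ≠ l → r₀ ≤ M.P k l) →
          SemiSup.IsAngleMinPlus M L D y →
          0 < SemiSup.bestRiskIns M Lᶜ ∧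
          -- every leave-one-out clustering is almost surely `b₀`-correct
          ((∀ i ∈ Lᶜ, ∀ᵐ ω ∂M.law, ω ∈ SemiSup.correctEvent M D b₀ i) →
            SemiSup.RateEfficient c (SemiSup.riskIns M y) (SemiSup.bestRiskIns M Lᶜ)) ∧
          -- the risk of AngleMin+ given the events that the clusterings are `b₀`-correct
          ((∀ i ∈ Lᶜ, M.law (SemiSup.correctEvent M D b₀ i) ≠ 0) →
            SemiSup.RateEfficient c
              (SemiSup.riskInsGiven M (SemiSup.correctEvent M D b₀) y)
              (SemiSup.bestRiskIns M Lᶜ)) := by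
  have hK0 : 0 < K := by lia
  have hKr : (0 : ℝ) < K := by exact_mod_cast hK0
  set c₀ : ℝ := 1 / (8 * K * C₂) with hc₀
  have hc₀0 : 0 < c₀ := by positivity
  obtain ⟨ε, hε0, hε, hε1, hε2⟩ := SemiSup.exists_noise_level hKr hC₁ hc₀0
  -- The noise level `ε` depends on `K, C₁, C₂` only, so the thresholds precede `r₀`. With `β ≤ K
  -- δ`, `c₃ ≤ ε / (2K)` bounds the bias by half the tolerance; `C₃ ≥ 2C₁ + 1` keeps edge
  -- probabilities at unlabeled nodes at most `1/2` and gives `C₃ ≥ 1`.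
  refine ⟨c₀, hc₀0, ε / (2 * K), by positivity, 2 * C₁ + 1, by positivity,
    fun r₀ hr₀ c₃ hc₃ hc₃' C₃ hC₃ => ?_⟩
  have hC₃0 : 0 < C₃ := by linarith
  -- The minimum with `1` covers the diagonal of `P`.
  set r := min r₀ 1 with hr
  have hr0 : 0 < r := by positivity
  set κ := ε ^ 2 / (32 * C₁ * C₃) with hκ
  have hκ0 : 0 < κ := by positivity
  set A := K * (4 * K * (K + 1)) * Real.exp (κ * (C₁ ^ 2 / (4 * c₀))) with hA
  have hA0 : 0 < A := by positivity
  -- The three terms serve concavity of `t ↦ t ^ c`, the comparison of the exponents `2 / r` and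
  -- `κ`, and the absorption of the prefactor `A`.
  set c := min 1 (min (κ * r / 2) (1 / (2 * A))) with hc
  have hc0 : 0 < c := by positivity
  have hcκ : c * (2 / r) ≤ κ := by
    have : c ≤ κ * r / 2 := (min_le_right _ _).trans (min_le_left _ _)
    rw [← mul_div_assoc, div_le_iff₀ hr0]
    linarith
  have hcA : c * (2 * A) ≤ 1 := by
    have : c ≤ 1 / (2 * A) := (min_le_right _ _).trans (min_le_right _ _)
    rwa [le_div_iff₀ (by positivity)] at this
  refine ⟨c, hc0, fun b₀ _ _ hb₀ n β M L D y hβ hU hM hCP hCθ hθ hθL _ hrP hy => ?_⟩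
  obtain ⟨k, l, hkl, hsep⟩ := SemiSup.exists_closest_rows hK M.P
  have hrle : ∀ k l, r ≤ M.P k l := fun k l => by
    by_cases h : k = l
    · rw [h, hM.P_diag]
      exact min_le_right _ _
    · exact (min_le_left _ _).trans (hrP k l h)
  have hpos : ∀ k l, 0 < M.P k l := fun k l => hr0.trans_le (hrle k l)
  have hi : ∀ i ∈ Lᶜ, 2 * C₁ * M.theta i ≤ 1 := fun i hiU => by
    have h1 := hθ i hiU
    rw [le_div_iff₀ hC₃0] at h1
    nlinarith [hM.theta_pos i]
  set δ := ‖M.P k - M.P l‖ with hδ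
  have hβδ : β ≤ K * δ := SemiSup.beta_le_card_mul_norm_sub hM.P_symm hβ.le hCP hkl
  have hδ0 : 0 < δ := by
    by_contra! h
    nlinarith
  have hbias : ∀ m, M.l2sq (M.comm L m) ≤
      ε * δ * M.l1 Finset.univ * M.l1 (M.comm L m) / 2 := fun m => by
    have h1 := M.l1_nonneg (M.comm L m)
    have h2 := M.l1_nonneg Finset.univ
    calc _ ≤ c₃ * β * M.l1 (M.comm L m) * M.l1 Finset.univ := hCθ.2 m
      _ ≤ ε / (2 * K) * (K * δ) * M.l1 (M.comm L m) * M.l1 Finset.univ := by gcongr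
      _ = _ := by field_simp
  have hx : ∀ i ∈ Lᶜ, 0 ≤ δ ^ 2 * M.theta i * M.l1 Finset.univ := fun i _ =>
    mul_nonneg (mul_nonneg (sq_nonneg _) (hM.theta_pos i).le) (M.l1_nonneg _)
  have hlow := SemiSup.le_bestRiskIns hK0 fun y : SemiSup.Classifier n K Lᶜ =>
    SemiSup.le_riskIns hM hCP.1 hi hr0 hrle hkl y
  have hbest : 0 < SemiSup.bestRiskIns M Lᶜ := by
    refine lt_of_lt_of_le (div_pos ?_ (by exact_mod_cast hU.card_pos)) hlow
    exact Finset.sum_pos (fun i _ => by positivity) hU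
  have hgiven : (∀ i ∈ Lᶜ, M.law (SemiSup.correctEvent M D b₀ i) ≠ 0) →
      SemiSup.RateEfficient c (SemiSup.riskInsGiven M (SemiSup.correctEvent M D b₀) y)
        (SemiSup.bestRiskIns M Lᶜ) := by
    intro hB
    have hB' : ∀ i ∈ Lᶜ, M.law.real (SemiSup.correctEvent M D b₀ i) ≠ 0 := fun i hiU =>
      (measureReal_ne_zero_iff (measure_ne_top _ _)).2 (hB i hiU)
    refine SemiSup.RateEfficient.of_mul_le_rpow hc0
      (SemiSup.riskInsGiven_pos hM hU hCP.1 hpos hi hkl hB' y) hbest ?_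
    refine SemiSup.mul_le_rpow_of_exp_averages Lᶜ hU hx hc0 (min_le_left _ _) hcκ hcA hlow ?_
    unfold SemiSup.riskInsGiven
    gcongr
    rw [← Finset.sum_coe_sort Lᶜ]
    refine Finset.sum_le_sum fun i _ => ?_
    refine SemiSup.sum_cond_error_le hM hK0 hCP.1 i.2 (hi i i.2) hC₁ hC₂ (by linarith) hc₀ hδ0
      (SemiSup.norm_row_sub_le hM hCP.1 k l) hε0.le hε hε1 hε2 hsep (hθL i i.2) hbias hb₀ hCθ.1
      (fun m h => hB' i i.2 ?_) hy hκ
    have := SemiSup.law_relabel_real_eq_zero hM hCP.1 hpos (hi i i.2) m (M.label i) h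
    rwa [SemiSup.Params.relabel_label] at this
  refine ⟨hbest, fun hae => ?_, hgiven⟩
  have hcompl : ∀ i ∈ Lᶜ, M.law.real (SemiSup.correctEvent M D b₀ i)ᶜ = 0 := fun i hiU => by
    rw [measureReal_eq_zero_iff]
    exact hae i hiU
  rw [← SemiSup.riskInsGiven_eq_riskIns hM hCP.1 hpos hi hcompl y]
  -- A null event whose complement is also null contradicts total mass `1`.
  refine hgiven fun i hiU h0 => ?_
  have h1 := MeasureTheory.measure_univ_le_add_compl (μ := M.law) (SemiSup.correctEvent M D b₀ i)
  have h2 : M.law (SemiSup.correctEvent M D b₀ i)ᶜ = 0 := hae i hiU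
  rw [h0, h2, measure_univ] at h1
  simp at h1
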